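/- Let $K$ be a simplicial complex with vertex set $[m]=\{1,\dots,m\}$ (every singleton $\{v\}$, $v\in[m]$, is a simplex of $K$, and so is $\varnothing$), and let $\mathbb F$ be a field. Let $\mathbb F[K]=\mathbb F[v_1,\dots,v_m]/\mathcal I_K$ be its Stanley–Reisner ring, where $\mathcal I_K$ is generated by the squarefree monomials $v_{i_1}\cdots v_{i_s}$ with $\{i_1,\dots,i_s\}\notin K$. With $\deg v_l=2$, put $$\beta^{-i,2j}(\mathbb F[K])=\dim_{\mathbb F}\mathrm{Tor}^{-i,2j}_{\mathbb F[v_1,\dots,v_m]}(\mathbb F[K],\mathbb F),\qquad \beta^{-i}(\mathbb F[K])=\sum_{j\ge 0}\beta^{-i,2j}(\mathbb F[K]),\qquad \widetilde D(K)=\sum_{i\ge 0}\beta^{-i}(\mathbb F[K]),$$ where $\mathrm{Tor}^{-i,2j}$ is the part of $\mathrm{Tor}_i$ of internal degree $2j$ (so it is $0$ for $i<0$). Let $\mathrm{mdim}(K)$ be the minimal dimension $|\sigma|-1$ of an inclusion-maximal simplex $\sigma$ of $K$. Then $$\beta^{-i}(\mathbb F[K])\ \ge\ \binom{m-\mathrm{mdim}(K)-1}{i}\qquad\text{for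 every } 0\le i\le m-\mathrm{mdim}(K)-1 .$$ Moreover, for every vertex $v$ of $K$, let $\mathrm{link}_Kv=\{\tau\in K: v\notin\tau,\ \tau\cup\{v\}\in K\}$, regarded as a simplicial complex on its own vertex set $V(\mathrm{link}_Kv)=\{u\neq v:\{u,v\}\in K\}$, let $m_v=|V(\mathrm{link}_Kv)|$, and let $K\setminus v$ be the full subcomplex of $K$ on $[m]\setminus\{v\}$. Then for all $i,j\ge 0$: (a) $\displaystyle \beta^{-i,2(j+1)}(\mathbb F[K])\ \ge\ \sum_{0\le s\le j}\binom{m-m_v-1}{s}\,\beta^{-(i-s),2(j-s)}(\mathbb F[\mathrm{link}_Kv])+\beta^{-i,2(j+1)}(\mathbb F[K\setminus v])-\beta^{-i,2j}(\mathbb F[K\setminus v]);$ (b) $\displaystyle \beta^{-i}(\mathbb F[K])\ \ge\ \sum_{0\le s\le i}\binom{m-m_v-1}{s}\,\beta^{-(i-s)}(\mathbb F[\mathrm{link}_Kv]);$ (c) $\displaystyle \widetilde D(K)\ \ge\ 2^{\,m-m_v-1}\,\widetilde D(\mathrm{link}_Kv).$ -/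

import Mathlib

namespace StanleyReisner

/-! ### Simplicial complexes

A simplicial complex whose vertex set is exactly the finite type `V` is Mathlib's
`AbstractSimplicialComplex V` (all singletons are faces). Mathlib only records the nonempty faces,
so the empty simplex is added by hand where it matters. -/

section Complexes

variable {V : Type*}

/-- The set of all simplices of `K`, the empty simplex included. -/
def simplices (K : AbstractSimplicialComplex V) : Set (Finset V) :=
  {σ | σ = ∅ ∨ σ ∈ K.faces}

/-- The maximal simplices of `K` with respect to inclusion. -/
def maximalSimplices (K : AbstractSimplicialComplex V) : Set (Finset V) :=
  {σ | Maximal (fun τ => τ ∈ simplices K) σ}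

/-- `mdim K`: the least dimension `|σ| - 1` of a maximal simplex `σ` of `K`
(equal to `-1` for the irrelevant complex, whose only simplex is `∅`). -/
noncomputable def mdim (K : AbstractSimplicialComplex V) : ℤ :=
  sInf ((fun σ : Finset V => (σ.card : ℤ) - 1) '' maximalSimplices K)

variable [DecidableEq V]

/-- The vertex set of the link of `v`: the vertices `u ≠ v` such that `{v, u}` is a simplex. -/
abbrev LinkVertex (K : AbstractSimplicialComplex V) (v : V) : Type _ :=
  {u : V // u ≠ v ∧ ({v, u} : Finset V) ∈ K.faces}

noncomputable instance [Fintype V] (K : AbstractSimplicialComplex V) (v : V) :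
    Fintype (LinkVertex K v) :=
  Fintype.ofFinite _

/-- The link of the vertex `v`, as a simplicial complex on its own vertex set: its simplices are
the `τ` not containing `v` such that `{v} ∪ τ` is a simplex of `K`. -/
def link (K : AbstractSimplicialComplex V) (v : V) :
    AbstractSimplicialComplex (LinkVertex K v) where
  faces := {τ | τ.Nonempty ∧ insert v (τ.map (Function.Embedding.subtype _)) ∈ K.faces}
  isRelLowerSet_faces := by
    intro τ hτ
    refine ⟨hτ.1, fun ρ hρ hne => ⟨hne, ?_⟩⟩
    exact (K.isRelLowerSet_faces hτ.2).2
      (Finset.insert_subset_insert _ (Finset.map_subset_map.2 hρ)) (Finset.insert_nonempty _ _)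
  singleton_mem := by
    intro u
    refine ⟨Finset.singleton_nonempty _, ?_⟩
    simpa using u.2.2

/-- `K ∖ v`: the full subcomplex of `K` on all vertices different from `v`. -/
def deletion (K : AbstractSimplicialComplex V) (v : V) :
    AbstractSimplicialComplex {u : V // u ≠ v} where
  faces := {τ | τ.map (Function.Embedding.subtype _) ∈ K.faces}
  isRelLowerSet_faces := by
    intro τ hτ
    refine ⟨Finset.map_nonempty.1 (K.isRelLowerSet_faces hτ).1, fun ρ hρ hne => ?_⟩
    exact (K.isRelLowerSet_faces hτ).2 (Finset.map_subset_map.2 hρ) (Finset.map_nonempty.2 hne)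
  singleton_mem := by
    intro u
    simpa using K.singleton_mem u

end Complexes

/-! ### Graded Tor against the residue field

Let `S = F[v_x : x ∈ V]`. The Koszul complex `S ⊗ Λ[u_x : x ∈ V]`, `d u_x = v_x`, is a graded free
resolution of the trivial module `F` (see `koszulD_exact` below). So for a graded `S`-module `M`,
the bigraded vector space `Tor_S (M, F)` is the homology of `M ⊗ Λ[u_x : x ∈ V]`. (Mathlib's `Tor` carries no internal grading.)
An element `∑_J f_J u_J` of the latter is recorded as the function `J ↦ f_J` on finite subsets. -/

section Koszul

/-- Sign bookkeeping for the Koszul differential. -/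
theorem koszulSign_insert {V : Type*} [LinearOrder V] (J : Finset V) (x y : V) (hx : x ∉ J) :
    ((insert x J).filter (· < y)).card = (J.filter (· < y)).card + if x < y then 1 else 0 := by
  rw [Finset.filter_insert]
  split_ifs with h
  · rw [Finset.card_insert_of_notMem (by simp [hx])]
  · simp

variable {V : Type*} [Fintype V] [LinearOrder V] {F : Type*} [Field F]

/-- The Koszul differential of `M ⊗ Λ[u_x : x ∈ V]`: for `x₁ < ⋯ < x_k`,
`d (u_{x₁} ⋯ u_{x_k}) = ∑_r (-1)^(r-1) v_{x_r} u_{x₁} ⋯ (omit u_{x_r}) ⋯ u_{x_k}`. -/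
noncomputable def koszulD (V : Type*) [Fintype V] [LinearOrder V] (F : Type*) [Field F]
    (M : Type*) [AddCommGroup M] [Module (MvPolynomial V F) M] :
    (Finset V → M) →ₗ[MvPolynomial V F] (Finset V → M) :=
  LinearMap.pi fun J => ∑ x ∈ Jᶜ,
    ((-1 : MvPolynomial V F) ^ (J.filter (· < x)).card * MvPolynomial.X x) •
      LinearMap.proj (insert x J)

theorem koszulD_apply (M : Type*) [AddCommGroup M] [Module (MvPolynomial V F) M]
    (f : Finset V → M) (J : Finset V) :
    koszulD V F M f J = ∑ x ∈ Jᶜ,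
      ((-1 : MvPolynomial V F) ^ (J.filter (· < x)).card * MvPolynomial.X x) • f (insert x J) := by
  simp [koszulD]

theorem koszulD_comp_koszulD (M : Type*) [AddCommGroup M] [Module (MvPolynomial V F) M]
    (f : Finset V → M) : koszulD V F M (koszulD V F M f) = 0 := by
  ext J
  simp only [koszulD_apply, Finset.smul_sum, smul_smul, Pi.zero_apply]
  rw [Finset.sum_sigma']
  refine Finset.sum_involution (fun p _ => ⟨p.2, p.1⟩) ?_ ?_ ?_ ?_
  · rintro ⟨x, y⟩ h
    simp only [Finset.mem_sigma, Finset.mem_compl, Finset.mem_insert, not_or] at h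
    obtain ⟨hx, hyx, hy⟩ := h
    dsimp only
    rw [Finset.insert_comm y x, ← add_smul, koszulSign_insert _ _ _ hx, koszulSign_insert _ _ _ hy]
    have hs : ∀ (p : MvPolynomial V F) (z : M), p = 0 → p • z = 0 := by
      rintro p z rfl
      exact zero_smul _ _
    apply hs
    rcases lt_or_gt_of_ne hyx with h | h
    · simp only [h, h.not_gt, if_true, if_false]
      ring
    · simp only [h, h.not_gt, if_true, if_false]
      ring
  · rintro ⟨x, y⟩ h _ he
    simp only [Finset.mem_sigma, Finset.mem_compl, Finset.mem_insert, not_or] at h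
    simp only [Sigma.mk.injEq, heq_eq_eq] at he
    exact h.2.1 he.1
  · rintro ⟨x, y⟩ h
    simp only [Finset.mem_sigma, Finset.mem_compl, Finset.mem_insert, not_or] at h ⊢
    exact ⟨h.2.2, fun e => h.2.1 e.symm, h.1⟩
  · rintro ⟨x, y⟩ h
    rfl

open MvPolynomial in
theorem coeff_koszulD (f : Finset V → MvPolynomial V F) (J : Finset V) (b : V →₀ ℕ) :
    coeff b (koszulD V F (MvPolynomial V F) f J) = ∑ x ∈ Jᶜ,
      (-1 : F) ^ (J.filter (· < x)).card *
        if x ∈ b.support then coeff (b - Finsupp.single x 1) (f (insert x J)) else 0 := by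
  rw [koszulD_apply, coeff_sum]
  refine Finset.sum_congr rfl fun x _ => ?_
  have : ((-1 : MvPolynomial V F) ^ (J.filter (· < x)).card) =
    C ((-1 : F) ^ (J.filter (· < x)).card) := by simp
  rw [this, smul_eq_mul, mul_assoc, coeff_C_mul, coeff_X_mul']

open MvPolynomial in
/-- The Koszul complex of the polynomial ring itself is a resolution of `F`: a cycle is a boundary
as soon as the constant coefficient of its component in homological degree `0` vanishes. -/
theorem koszulD_exact (f : Finset V → MvPolynomial V F)
    (hf : koszulD V F (MvPolynomial V F) f = 0) (h0 : constantCoeff (f ∅) = 0) :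
    ∃ g, koszulD V F (MvPolynomial V F) g = f := by
  classical
  -- `x` is the least vertex occurring in `v^b u_J`, and it occurs in `u_J`
  let P : V → Finset V → (V →₀ ℕ) → Prop := fun x J b => x ∈ J ∧ ∀ y < x, y ∉ J ∧ b y = 0
  let c : Finset V → (V →₀ ℕ) → F := fun J b =>
    ∑ x, if P x J b then coeff (b + Finsupp.single x 1) (f (J.erase x)) else 0
  have hc : ∀ J, ∃ p : MvPolynomial V F, ∀ b, coeff b p = c J b := by
    intro J
    let s : Finset (V →₀ ℕ) := Finset.univ.biUnion fun x : V =>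
      (f (J.erase x)).support.image fun b => b - Finsupp.single x 1
    refine ⟨∑ b ∈ s, monomial b (c J b), fun b => ?_⟩
    rw [coeff_sum]
    simp only [coeff_monomial, Finset.sum_ite_eq']
    split_ifs with hb
    · rfl
    · symm
      refine Finset.sum_eq_zero fun x _ => ?_
      split_ifs
      · by_contra hne
        exact hb (Finset.mem_biUnion.2 ⟨x, Finset.mem_univ _, Finset.mem_image.2
          ⟨b + Finsupp.single x 1, mem_support_iff.2 hne, by simp⟩⟩)
      · rfl
  choose g hg using hc
  have hP : ∀ {x J b}, P x J b → c J b = coeff (b + Finsupp.single x 1) (f (J.erase x)) := by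
    intro x J b h
    refine (Finset.sum_eq_single x ?_ (by simp)).trans (if_pos h)
    intro y _ hy
    refine if_neg fun h' => ?_
    rcases lt_or_gt_of_ne hy with hlt | hlt
    · exact (h.2 _ hlt).1 h'.1
    · exact (h'.2 _ hlt).1 h.1
  refine ⟨g, ?_⟩
  ext J b
  by_cases hJb : (J ∪ b.support).Nonempty
  swap
  · rw [Finset.not_nonempty_iff_eq_empty, Finset.union_eq_empty, Finsupp.support_eq_empty] at hJb
    obtain ⟨rfl, rfl⟩ := hJb
    rw [coeff_koszulD]
    rw [constantCoeff_eq] at h0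
    simpa using h0.symm
  obtain ⟨x, hxm, hmin⟩ : ∃ x ∈ J ∪ b.support, ∀ y < x, y ∉ J ∧ b y = 0 := by
    refine ⟨(J ∪ b.support).min' hJb, Finset.min'_mem _ _, fun y hy => ?_⟩
    have : y ∉ J ∪ b.support := fun h => (Finset.min'_le _ _ h).not_gt hy
    simpa [not_or] using this
  rw [coeff_koszulD]
  simp only [hg]
  by_cases hxJ : x ∈ J
  · have key := congrArg (coeff (b + Finsupp.single x 1)) (congrFun hf (J.erase x))
    rw [coeff_koszulD, Finset.compl_erase, Finset.sum_insert (by simpa using hxJ)] at key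
    have h1 : ((J.erase x).filter (· < x)).card = 0 := by
      rw [Finset.card_eq_zero, Finset.filter_eq_empty_iff]
      intro y hy hlt
      exact (hmin y hlt).1 (Finset.mem_of_mem_erase hy)
    rw [h1, if_pos (by simp), Finset.insert_erase hxJ] at key
    simp only [pow_zero, one_mul, add_tsub_cancel_right, Pi.zero_apply, coeff_zero] at key
    rw [eq_neg_of_add_eq_zero_left key, ← Finset.sum_neg_distrib]
    refine Finset.sum_congr rfl fun y hy => ?_
    have hyJ : y ∉ J := by simpa using hy
    have hxy : x ≠ y := fun h => hyJ (h ▸ hxJ)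
    have hlt : x < y ∨ y < x := lt_or_gt_of_ne hxy
    have hsupp : y ∈ (b + Finsupp.single x 1).support ↔ y ∈ b.support := by
      simp [hxy]
    by_cases hyb : y ∈ b.support
    · rw [if_pos hyb, if_pos (hsupp.2 hyb)]
      have hxlt : x < y := hlt.resolve_right fun h => by
        simp [(hmin y h).2] at hyb
      rw [hP (x := x), Finset.erase_insert_of_ne hxy.symm]
      · have h2 : (J.filter (· < y)).card = ((J.erase x).filter (· < y)).card + 1 := by
          conv_lhs => rw [← Finset.insert_erase hxJ]
          rw [koszulSign_insert _ _ _ (by simp), if_pos hxlt]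
        have h3 : b - Finsupp.single y 1 + Finsupp.single x 1 =
            b + Finsupp.single x 1 - Finsupp.single y 1 := by
          ext z
          simp only [Finsupp.add_apply, Finsupp.tsub_apply, Finsupp.single_apply]
          by_cases hz : y = z
          · subst hz; simp [hxy]
          · simp [hz]
        rw [h2, h3, pow_succ]
        ring
      · refine ⟨Finset.mem_insert_of_mem hxJ, fun z hz => ⟨?_, ?_⟩⟩
        · rw [Finset.mem_insert, not_or]
          exact ⟨(hz.trans hxlt).ne, (hmin z hz).1⟩
        · simp [(hmin z hz).2]
    · rw [if_neg hyb, if_neg (fun h => hyb (hsupp.1 h))]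
      simp
  · have hxb : x ∈ b.support := (Finset.mem_union.1 hxm).resolve_left hxJ
    rw [Finset.sum_eq_single x]
    · have h1 : (J.filter (· < x)).card = 0 := by
        rw [Finset.card_eq_zero, Finset.filter_eq_empty_iff]
        intro y hy hlt
        exact (hmin y hlt).1 hy
      rw [if_pos hxb, h1, hP (x := x), Finset.erase_insert hxJ, tsub_add_cancel_of_le]
      · simp
      · exact Finsupp.single_le_iff.2 (Nat.one_le_iff_ne_zero.2 (Finsupp.mem_support_iff.1 hxb))
      · refine ⟨Finset.mem_insert_self _ _, fun z hz => ⟨?_, ?_⟩⟩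
        · rw [Finset.mem_insert, not_or]
          exact ⟨hz.ne, (hmin z hz).1⟩
        · simp [(hmin z hz).2]
    · intro y hy hyx
      have hyJ : y ∉ J := by simpa using hy
      split_ifs with hyb
      · have hxlt : x < y := by
          rcases lt_or_gt_of_ne hyx with h | h
          · simp [(hmin y h).2] at hyb
          · exact h
        have : c (insert y J) (b - Finsupp.single y 1) = 0 := by
          refine Finset.sum_eq_zero fun z _ => if_neg fun h => ?_
          -- `x` lies below `z` and divides the monomial
          have hxz : x < z := by
            rcases Finset.mem_insert.1 h.1 with rfl | hz
            · exact hxlt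
            · rcases lt_trichotomy x z with h' | h' | h'
              · exact h'
              · exact absurd (h' ▸ hz) hxJ
              · exact absurd hz (hmin z h').1
          have := (h.2 x hxz).2
          simp only [Finsupp.tsub_apply, Finsupp.single_apply, if_neg hyx, tsub_zero] at this
          exact Finsupp.mem_support_iff.1 hxb this
        rw [this, mul_zero]
      · simp
    · intro h
      exact absurd hxJ (by simpa using h)

variable {M : Type*} [AddCommGroup M] [Module (MvPolynomial V F) M] [Module F M]
  [IsScalarTower F (MvPolynomial V F) M]

/-- The part of `M ⊗ Λ[u_x : x ∈ V]` of homological degree `i` and internal degree `j`, where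
`𝓜 n` is the degree `n` part of `M` and all `v_x`, `u_x` have internal degree `1`. -/
def koszulPart (V : Type*) {F : Type*} [Field F] {M : Type*} [AddCommGroup M] [Module F M]
    (𝓜 : ℕ → Submodule F M) (i j : ℕ) : Submodule F (Finset V → M) :=
  Submodule.pi Set.univ fun J => if J.card = i ∧ i ≤ j then 𝓜 (j - i) else ⊥

/-- Cycles of bidegree `(i, j)`. -/
noncomputable def koszulCycles (𝓜 : ℕ → Submodule F M) (i j : ℕ) : Submodule F (Finset V → M) :=
  LinearMap.ker ((koszulD V F M).restrictScalars F) ⊓ koszulPart V 𝓜 i j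

/-- Boundaries of bidegree `(i, j)`. -/
noncomputable def koszulBoundaries (𝓜 : ℕ → Submodule F M) (i j : ℕ) :
    Submodule F (Finset V → M) :=
  (koszulPart V 𝓜 (i + 1) j).map ((koszulD V F M).restrictScalars F)

/-- The part of `Tor_S (M, F)` of homological degree `i` and internal degree `j`, for
`S = F[v_x : x ∈ V]` and a graded `S`-module `M` with homogeneous parts `𝓜 n`. -/
abbrev GradedTor (V : Type*) [Fintype V] [LinearOrder V] {F : Type*} [Field F]
    {M : Type*} [AddCommGroup M] [Module (MvPolynomial V F) M] [Module F M]
    [IsScalarTower F (MvPolynomial V F) M] (𝓜 : ℕ → Submodule F M) (i j : ℕ) : Type _ :=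
  (koszulCycles (V := V) 𝓜 i j) ⧸
    (koszulBoundaries (V := V) 𝓜 i j).submoduleOf (koszulCycles (V := V) 𝓜 i j)

end Koszul

/-! ### Stanley–Reisner rings and their Betti numbers -/

section Betti

/-- The Stanley–Reisner ideal: generated by the squarefree monomials of the non-simplices. -/
noncomputable def srIdeal {V : Type*} (F : Type*) [Field F] (K : AbstractSimplicialComplex V) :
    Ideal (MvPolynomial V F) :=
  Ideal.span {p | ∃ σ : Finset V, σ ∉ simplices K ∧ p = ∏ x ∈ σ, MvPolynomial.X x}

/-- The Stanley–Reisner ring `F[K]`. -/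
abbrev SRRing {V : Type*} (F : Type*) [Field F] (K : AbstractSimplicialComplex V) : Type _ :=
  MvPolynomial V F ⧸ srIdeal F K

/-- The homogeneous part of `F[K]` of polynomial degree `n`: the image of the space of homogeneous
polynomials of degree `n`. -/
noncomputable def srPart {V : Type*} (F : Type*) [Field F] (K : AbstractSimplicialComplex V)
    (n : ℕ) : Submodule F (SRRing F K) :=
  (MvPolynomial.homogeneousSubmodule V F n).map (Ideal.Quotient.mkₐ F (srIdeal F K)).toLinearMap

variable {V : Type*} [Fintype V] [LinearOrder V]

/-- The bigraded Betti number `β^{-i,2j}(F[K]) = dim_F Tor^{-i,2j}(F[K], F)`. The convention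
`deg v_x = 2` doubles the polynomial degree, hence `2j` stands for polynomial degree `j`. -/
noncomputable def bigradedBetti (F : Type*) [Field F] (K : AbstractSimplicialComplex V)
    (i j : ℕ) : ℕ :=
  Module.finrank F (GradedTor V (srPart F K) i j)

/-- The Betti number `β^{-i}(F[K]) = ∑_{j ≥ 0} β^{-i,2j}(F[K])` (only finitely many terms are
nonzero). -/
noncomputable def betti (F : Type*) [Field F] (K : AbstractSimplicialComplex V) (i : ℕ) : ℕ :=
  ∑ᶠ j : ℕ, bigradedBetti F K i j

/-- The total Betti number `D̃(K; F) = ∑_{i ≥ 0} β^{-i}(F[K])` (only finitely many terms are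
nonzero). -/
noncomputable def totalBetti (F : Type*) [Field F] (K : AbstractSimplicialComplex V) : ℕ :=
  ∑ᶠ i : ℕ, betti F K i

end Betti

end StanleyReisner

set_option linter.unusedSectionVars false

/-! The Koszul complex `F[K] ⊗ Λ` is graded by exponent vectors, and its strand in multidegree `a`
is a complex of scalar functions of finite sets `J` (the coefficient of `v^(a-J) u_J`). If some
entry of `a` is at least 2, the strand is a cone and acyclic. If `a` is the indicator of `W`, it
consists of the `J ⊆ W` with `W \ J` a simplex. Up to signs this is the augmented cochain complex of
the full subcomplex `K_W`, with homological degree `i` matching cohomological degree `|W| - i - 1`.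
This is Hochster's formula `bigradedBetti_eq_sum_complFamily`; from there on everything is a
statement about families of finite sets.

For a vertex `v` and `W` not containing `v`, the strand of `W ∪ {v}` is the mapping cone of the
restriction from the strand of `K` on `W` to that of `link v` on `W`. Exactness of `H_i(K on W) →
H_i(link v on W) → H_i(K on W ∪ {v})` in the middle bounds the dimension for the link by the sum of
the other two (`relBetti_complFamily_le`). Now sum over all `W` of size `j`. The first outer terms
add up to the Betti number of `K ∖ v` in degree `j`, the second to those of `K` minus those of `K ∖
v` in degree `j + 1`. On the link side, the vertices of `W` that are neither `v` nor in the link are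
ghost vertices: `s` of them merely shift the homology by `s`, and they can be chosen in `(m - m_v -
1).choose s` ways (`sum_relBetti_linkFamily`). This gives (a).

Summing (a) over `j` telescopes the deletion terms and gives (b); summing (b) over `i` gives (c),
since the binomial coefficients add up to a power of 2. The binomial lower bound holds with `|σ| -
1` in place of `mdim` for every maximal simplex `σ`. It follows from (b) by induction on `|σ|`: pass
to the link of a vertex of `σ` and apply Vandermonde's identity. -/

namespace StanleyReisner

/-! ### Dimensions of subquotients of vector spaces -/

section Subquotients

variable {F : Type*} [Field F] {X Y Y' : Type*} [AddCommGroup X] [Module F X]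
  [AddCommGroup Y] [Module F Y] [AddCommGroup Y'] [Module F Y']

/-- If a family of linear maps identifies the subquotient `Z / B` with the product of the
subquotients `Z' a / B' a`, then the dimensions agree. -/
theorem finrank_subquotient_eq_sum {ι : Type*} [Fintype ι] [FiniteDimensional F Y]
    (Z B : Submodule F X) (Z' B' : ι → Submodule F Y) (θ : ι → X →ₗ[F] Y)
    (hZ : ∀ z ∈ Z, ∀ a, θ a z ∈ Z' a)
    (hB : ∀ z ∈ Z, (z ∈ B ↔ ∀ a, θ a z ∈ B' a))
    (hsurj : ∀ y : ι → Y, (∀ a, y a ∈ Z' a) → ∃ z ∈ Z, ∀ a, θ a z = y a) :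
    Module.finrank F (Z ⧸ B.submoduleOf Z) =
      ∑ a, Module.finrank F (Z' a ⧸ (B' a).submoduleOf (Z' a)) := by
  let φ : Z →ₗ[F] ∀ a, Z' a ⧸ (B' a).submoduleOf (Z' a) :=
    LinearMap.pi fun a => ((B' a).submoduleOf (Z' a)).mkQ ∘ₗ
      LinearMap.codRestrict (Z' a) (θ a ∘ₗ Z.subtype) fun z => hZ z z.2 a
  have hker : LinearMap.ker φ = B.submoduleOf Z := by
    ext z
    rw [LinearMap.mem_ker, funext_iff]
    refine Iff.trans (forall_congr' fun a => ?_) (hB _ z.2).symm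
    exact Submodule.Quotient.mk_eq_zero _
  have hφ : Function.Surjective φ := by
    intro q
    choose y hy using fun a => Submodule.mkQ_surjective _ (q a)
    obtain ⟨z, hz, hzy⟩ := hsurj (fun a => (y a : Y)) fun a => (y a).2
    refine ⟨⟨z, hz⟩, funext fun a => ?_⟩
    rw [← hy a]
    have : LinearMap.codRestrict (Z' a) (θ a ∘ₗ Z.subtype) (fun z => hZ z z.2 a) ⟨z, hz⟩ = y a :=
      Subtype.ext (hzy a)
    simp [φ, this]
  rw [← Module.finrank_pi_fintype F, ← hker]
  exact (φ.quotKerEquivOfSurjective hφ).finrank_eq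

/-- A linear map that identifies two subquotients preserves the dimension. -/
theorem finrank_subquotient_eq [FiniteDimensional F Y]
    (Z B : Submodule F X) (Z' B' : Submodule F Y) (θ : X →ₗ[F] Y)
    (hZ : ∀ z ∈ Z, θ z ∈ Z') (hB : ∀ z ∈ Z, (z ∈ B ↔ θ z ∈ B'))
    (hsurj : ∀ y ∈ Z', ∃ z ∈ Z, θ z = y) :
    Module.finrank F (Z ⧸ B.submoduleOf Z) = Module.finrank F (Z' ⧸ B'.submoduleOf Z') := by
  have := finrank_subquotient_eq_sum (ι := Unit) Z B (fun _ => Z') (fun _ => B') (fun _ => θ)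
    (fun z hz _ => hZ z hz) (fun z hz => by simpa using hB z hz)
    (fun y hy => by
      obtain ⟨z, hz, h⟩ := hsurj (y ()) (hy ())
      exact ⟨z, hz, fun _ => h⟩)
  simpa using this

/-- If `Z₁ / B₁ → Z₂ / B₂ → Z₃ / B₃` is exact in the middle, then the dimension of the middle term
is at most the sum of the dimensions of the outer ones. -/
theorem finrank_subquotient_le_add [FiniteDimensional F X] [FiniteDimensional F Y]
    [FiniteDimensional F Y'] (Z₁ B₁ : Submodule F X) (Z₂ B₂ : Submodule F Y)
    (Z₃ B₃ : Submodule F Y') (f : X →ₗ[F] Y) (g : Y →ₗ[F] Y')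
    (hfZ : ∀ z ∈ Z₁, f z ∈ Z₂) (hfB : ∀ z ∈ B₁, f z ∈ B₂)
    (hgZ : ∀ z ∈ Z₂, g z ∈ Z₃) (hgB : ∀ z ∈ B₂, g z ∈ B₃)
    (hex : ∀ z ∈ Z₂, g z ∈ B₃ → ∃ a ∈ Z₁, z - f a ∈ B₂) :
    Module.finrank F (Z₂ ⧸ B₂.submoduleOf Z₂) ≤
      Module.finrank F (Z₁ ⧸ B₁.submoduleOf Z₁) + Module.finrank F (Z₃ ⧸ B₃.submoduleOf Z₃) := by
  let f' : (Z₁ ⧸ B₁.submoduleOf Z₁) →ₗ[F] (Z₂ ⧸ B₂.submoduleOf Z₂) :=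
    Submodule.mapQ _ _ (f.restrict hfZ) fun z hz => hfB z hz
  let g' : (Z₂ ⧸ B₂.submoduleOf Z₂) →ₗ[F] (Z₃ ⧸ B₃.submoduleOf Z₃) :=
    Submodule.mapQ _ _ (g.restrict hgZ) fun z hz => hgB z hz
  have hle : LinearMap.ker g' ≤ LinearMap.range f' := by
    intro q hq
    obtain ⟨z, rfl⟩ := Submodule.mkQ_surjective _ q
    have hz : g z ∈ B₃ := by
      exact (Submodule.Quotient.mk_eq_zero (B₃.submoduleOf Z₃) (x := g.restrict hgZ z)).1 hq
    obtain ⟨a, ha, hza⟩ := hex z z.2 hz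
    refine ⟨Submodule.mkQ _ ⟨a, ha⟩, ?_⟩
    symm
    exact (Submodule.Quotient.eq _).2 hza
  have h1 := Submodule.finrank_mono hle
  have h2 := LinearMap.finrank_range_add_finrank_ker g'
  have h3 := Submodule.finrank_le (LinearMap.range g')
  have h4 := LinearMap.finrank_range_le f'
  omega

end Subquotients

/-! ### Scalar Koszul complexes on families of finite sets -/

section RelativeComplex

variable {V : Type*} [Fintype V] [LinearOrder V] {F : Type*} [Field F]

/-- The Koszul differential on scalar functions of finite sets, truncated to a family `Q`. -/
noncomputable def relD (F : Type*) [Field F] (Q : Set (Finset V)) :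
    (Finset V → F) →ₗ[F] (Finset V → F) where
  toFun c := Q.indicator fun J => ∑ x ∈ Jᶜ, (-1) ^ (J.filter (· < x)).card * c (insert x J)
  map_add' c c' := by
    rw [← Set.indicator_add']
    congr 1
    ext J
    simp [mul_add, Finset.sum_add_distrib]
  map_smul' r c := by
    ext J
    by_cases hJ : J ∈ Q
    · simp [hJ, Finset.mul_sum, mul_left_comm]
    · simp [hJ]

theorem relD_apply_of_mem {Q : Set (Finset V)} (c : Finset V → F) {J : Finset V} (hJ : J ∈ Q) :
    relD F Q c J = ∑ x ∈ Jᶜ, (-1) ^ (J.filter (· < x)).card * c (insert x J) :=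
  Set.indicator_of_mem (f := fun J => ∑ x ∈ Jᶜ, (-1) ^ (J.filter (· < x)).card * c (insert x J))
    hJ

theorem relD_apply_of_notMem {Q : Set (Finset V)} (c : Finset V → F) {J : Finset V}
    (hJ : J ∉ Q) : relD F Q c J = 0 :=
  Set.indicator_of_notMem
    (f := fun J => ∑ x ∈ Jᶜ, (-1) ^ (J.filter (· < x)).card * c (insert x J)) hJ

/-- Functions supported on the members of `Q` of cardinality `i`. -/
def relChains (F : Type*) [Field F] (Q : Set (Finset V)) (i : ℕ) : Submodule F (Finset V → F) where
  carrier := {c | ∀ J, c J ≠ 0 → J ∈ Q ∧ J.card = i}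
  zero_mem' := by simp
  add_mem' := by
    intro c c' hc hc' J hJ
    by_cases h : c J = 0
    · exact hc' J fun h' => hJ (by simp [h, h'])
    · exact hc J h
  smul_mem' := by
    intro r c hc J hJ
    exact hc J fun h => hJ (by simp [h])

/-- Cycles of the truncated complex. -/
noncomputable def relCycles (F : Type*) [Field F] (Q : Set (Finset V)) (i : ℕ) :
    Submodule F (Finset V → F) :=
  LinearMap.ker (relD F Q) ⊓ relChains F Q i

/-- Boundaries of the truncated complex. -/
noncomputable def relBoundaries (F : Type*) [Field F] (Q : Set (Finset V)) (i : ℕ) :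
    Submodule F (Finset V → F) :=
  (relChains F Q (i + 1)).map (relD F Q)

theorem mem_relCycles {Q : Set (Finset V)} {i : ℕ} {c : Finset V → F} :
    c ∈ relCycles F Q i ↔ relD F Q c = 0 ∧ c ∈ relChains F Q i := Iff.rfl

theorem mem_relBoundaries {Q : Set (Finset V)} {i : ℕ} {c : Finset V → F} :
    c ∈ relBoundaries F Q i ↔ ∃ w ∈ relChains F Q (i + 1), relD F Q w = c := Iff.rfl

/-- The dimension of the homology of the truncated complex. -/
noncomputable def relBetti (F : Type*) [Field F] (Q : Set (Finset V)) (i : ℕ) : ℕ :=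
  Module.finrank F (relCycles F Q i ⧸ (relBoundaries F Q i).submoduleOf (relCycles F Q i))

theorem relBetti_eq_zero_of_le {Q : Set (Finset V)} {i : ℕ}
    (h : relCycles F Q i ≤ relBoundaries F Q i) : relBetti F Q i = 0 := by
  have : (relBoundaries F Q i).submoduleOf (relCycles F Q i) = ⊤ := by
    rw [Submodule.submoduleOf, Submodule.comap_subtype_eq_top]
    exact h
  have : Subsingleton (relCycles F Q i ⧸ (relBoundaries F Q i).submoduleOf (relCycles F Q i)) :=
    Submodule.Quotient.subsingleton_iff.2 this
  exact Module.finrank_zero_of_subsingleton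

theorem relBetti_eq_zero_of_card_ne {Q : Set (Finset V)} {i : ℕ} (h : ∀ J ∈ Q, J.card ≠ i) :
    relBetti F Q i = 0 := by
  refine relBetti_eq_zero_of_le fun c hc => ?_
  have : c = 0 := by
    ext J
    by_contra hJ
    exact h J (hc.2 J hJ).1 (hc.2 J hJ).2
  rw [this]
  exact zero_mem _

theorem neg_one_pow_mul_self (n : ℕ) : ((-1 : F) ^ n) * (-1) ^ n = 1 := by
  rw [← mul_pow]; simp

/-- Exactly one of `x < y` and `y < x` holds, so exactly one of the two insertions adds a sign. This
is the anticommutation of `u_x` and `u_y`. -/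
theorem koszulSign_swap (J : Finset V) {x y : V} (hx : x ∉ J) (hy : y ∉ J) (hxy : x ≠ y) :
    ((-1 : F) ^ ((insert x J).filter (· < y)).card) * (-1) ^ ((insert y J).filter (· < x)).card =
      -((-1) ^ (J.filter (· < y)).card * (-1) ^ (J.filter (· < x)).card) := by
  rw [koszulSign_insert _ _ _ hx, koszulSign_insert _ _ _ hy]
  rcases lt_or_gt_of_ne hxy with h | h
  · simp only [h, h.not_gt, if_true, if_false]
    ring
  · simp only [h, h.not_gt, if_true, if_false]
    ring

/-- If membership in `Q` does not depend on the vertex `x`, the truncated complex is acyclic. -/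
theorem relBetti_eq_zero_of_cone {Q : Set (Finset V)} (x : V)
    (hQ : ∀ J, x ∉ J → (insert x J ∈ Q ↔ J ∈ Q)) (i : ℕ) : relBetti F Q i = 0 := by
  refine relBetti_eq_zero_of_le fun c hc => ?_
  obtain ⟨hd, hc⟩ := mem_relCycles.1 hc
  -- Contracting homotopy: `w` is the exterior product of `u_x` with `c`, and the claim is `d w =
  -- c`.
  let w : Finset V → F := fun J =>
    if x ∈ J then (-1) ^ ((J.erase x).filter (· < x)).card * c (J.erase x) else 0
  refine mem_relBoundaries.2 ⟨w, ?_, ?_⟩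
  · intro J hJ
    have hx : x ∈ J := by
      by_contra hx
      exact hJ (if_neg hx)
    simp only [w, if_pos hx] at hJ
    obtain ⟨h1, h2⟩ := hc _ (right_ne_zero_of_mul hJ)
    rw [← hQ _ (Finset.notMem_erase x J), Finset.insert_erase hx] at h1
    refine ⟨h1, ?_⟩
    rw [← Finset.card_erase_add_one hx, h2]
  · ext J
    by_cases hJ : J ∈ Q
    swap
    · rw [relD_apply_of_notMem _ hJ]
      by_contra h
      exact hJ (hc J (Ne.symm h)).1
    rw [relD_apply_of_mem _ hJ]
    by_cases hx : x ∈ J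
    · obtain ⟨J, hxJ, rfl⟩ : ∃ J', x ∉ J' ∧ insert x J' = J :=
        ⟨J.erase x, Finset.notMem_erase x J, Finset.insert_erase hx⟩
      -- For `J` without `x`, the cycle condition at `J` expresses `c (insert x J)` through the
      -- values `c (insert y J)` with `y ≠ x`; these are the terms of `d w` at `insert x J`.
      have key := congrFun hd J
      rw [relD_apply_of_mem _ ((hQ J hxJ).1 hJ), ← Finset.insert_erase (Finset.mem_compl.2 hxJ),
        Finset.sum_insert (Finset.notMem_erase _ _), ← Finset.compl_insert] at key
      have h1 : ∑ y ∈ (insert x J)ᶜ, (-1) ^ ((insert x J).filter (· < y)).card *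
          w (insert y (insert x J)) = -((-1) ^ (J.filter (· < x)).card *
          ∑ y ∈ (insert x J)ᶜ, (-1) ^ (J.filter (· < y)).card * c (insert y J)) := by
        rw [Finset.mul_sum, ← Finset.sum_neg_distrib]
        refine Finset.sum_congr rfl fun y hy => ?_
        simp only [Finset.mem_compl, Finset.mem_insert, not_or] at hy
        have h2 : (insert y (insert x J)).erase x = insert y J := by
          rw [Finset.insert_comm, Finset.erase_insert]
          simp [Ne.symm hy.1, hxJ]
        simp only [w]
        rw [if_pos (by simp), h2, ← mul_assoc, koszulSign_swap J hxJ hy.2 (Ne.symm hy.1)]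
        ring
      rw [h1, eq_neg_of_add_eq_zero_right key, mul_neg, neg_neg, ← mul_assoc,
        neg_one_pow_mul_self, one_mul]
    · rw [Finset.sum_eq_single x]
      · simp only [w]
        rw [if_pos (Finset.mem_insert_self _ _), Finset.erase_insert hx, ← mul_assoc,
          neg_one_pow_mul_self, one_mul]
      · intro y _ hy
        simp only [w]
        rw [if_neg (by simp [hx, Ne.symm hy]), mul_zero]
      · intro h
        exact absurd hx (by simpa using h)

end RelativeComplex

/-! ### Relabelling vertices and adjoining a fixed set -/

section Transfer

variable {V : Type*} [Fintype V] [LinearOrder V] {F : Type*} [Field F]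

theorem mem_of_relD_ne_zero {Q : Set (Finset V)} {c : Finset V → F} {J : Finset V}
    (h : relD F Q c J ≠ 0) : J ∈ Q := by
  by_contra hJ
  exact h (relD_apply_of_notMem c hJ)

theorem relD_mem_relChains {Q : Set (Finset V)} {i : ℕ} {c : Finset V → F}
    (hc : c ∈ relChains F Q (i + 1)) : relD F Q c ∈ relChains F Q i := by
  intro J hJ
  have hJQ := mem_of_relD_ne_zero hJ
  refine ⟨hJQ, ?_⟩
  rw [relD_apply_of_mem c hJQ] at hJ
  obtain ⟨x, hx, hne⟩ := Finset.exists_ne_zero_of_sum_ne_zero hJ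
  have := (hc _ (right_ne_zero_of_mul hne)).2
  rw [Finset.card_insert_of_notMem (by simpa using hx)] at this
  omega

variable {U : Type*} [Fintype U] [LinearOrder U]

/-- A chain isomorphism that lowers the homological degree by `t` preserves homology. -/
theorem relBetti_eq_of_chainIso {Q : Set (Finset V)} {Q' : Set (Finset U)} (t : ℕ)
    (θ : (Finset V → F) →ₗ[F] (Finset U → F))
    (hθ : ∀ i, ∀ c ∈ relChains F Q (i + t), θ c ∈ relChains F Q' i)
    (hinj : ∀ c : Finset V → F, (∀ J, c J ≠ 0 → J ∈ Q) → θ c = 0 → c = 0)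
    (hsurj : ∀ i, ∀ y ∈ relChains F Q' i, ∃ c ∈ relChains F Q (i + t), θ c = y)
    (hd : ∀ i, ∀ c ∈ relChains F Q (i + t), θ (relD F Q c) = relD F Q' (θ c)) (i : ℕ) :
    relBetti F Q (i + t) = relBetti F Q' i := by
  refine finrank_subquotient_eq _ _ _ _ θ ?_ ?_ ?_
  · rintro z ⟨hz, hzc⟩
    refine mem_relCycles.2 ⟨?_, hθ i z hzc⟩
    rw [← hd i z hzc, show relD F Q z = 0 from hz, map_zero]
  · rintro z ⟨-, hzc⟩
    constructor
    · rintro ⟨w, hw, rfl⟩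
      have hw' : w ∈ relChains F Q (i + 1 + t) := by rwa [add_right_comm]
      exact ⟨θ w, hθ _ w hw', (hd _ w hw').symm⟩
    · rintro ⟨w', hw', h⟩
      obtain ⟨w, hw, rfl⟩ := hsurj _ w' hw'
      have hw2 : w ∈ relChains F Q (i + t + 1) := by rwa [add_right_comm]
      refine ⟨w, hw2, sub_eq_zero.1 (hinj _ (fun J hJ => ((relChains F Q (i + t)).sub_mem
        (relD_mem_relChains hw2) hzc J hJ).1) ?_)⟩
      rw [map_sub, hd _ w hw, h, sub_self]
  · rintro y ⟨hy, hyc⟩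
    obtain ⟨c, hc, rfl⟩ := hsurj i y hyc
    refine ⟨c, mem_relCycles.2 ⟨?_, hc⟩, rfl⟩
    have h0 : θ (relD F Q c) = 0 := by rw [hd i c hc]; exact hy
    exact hinj _ (fun J => mem_of_relD_ne_zero) h0

/-- Relabelling the vertices along `e` and adding a fixed set `T` of `t` new vertices to all members
of a family shifts the homology of the truncated complex by `t`. -/
theorem relBetti_map_union (e : U ↪o V) (T : Finset V) (hT : ∀ u, e u ∉ T)
    {Q' : Set (Finset U)} {Q : Set (Finset V)}
    (hQ : ∀ J, J ∈ Q ↔ ∃ J' ∈ Q', J'.map e.toEmbedding ∪ T = J) (i : ℕ) :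
    relBetti F Q (i + T.card) = relBetti F Q' i := by
  have hdisj : ∀ J' : Finset U, Disjoint (J'.map e.toEmbedding) T := by
    intro J'
    rw [Finset.disjoint_left]
    intro x hx
    obtain ⟨u, -, rfl⟩ := Finset.mem_map.1 hx
    exact hT u
  let φ : Finset U → Finset V := fun J' => J'.map e.toEmbedding ∪ T
  have hφ : Function.Injective φ := by
    intro J₁ J₂ h
    have h' := congrArg (· \ T) h
    simp only [φ, Finset.union_sdiff_cancel_right (hdisj _)] at h'
    exact Finset.map_injective _ h'
  have hφQ : ∀ {J'}, φ J' ∈ Q ↔ J' ∈ Q' := by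
    intro J'
    rw [hQ]
    constructor
    · rintro ⟨J, hJ, h⟩
      rwa [← hφ h]
    · intro h
      exact ⟨J', h, rfl⟩
  have hcard : ∀ J', (φ J').card = J'.card + T.card := by
    intro J'
    rw [Finset.card_union_of_disjoint (hdisj J'), Finset.card_map]
  -- Since `e` preserves the order, the Koszul signs on the two sides differ only by the elements of
  -- `T` below `e u`. Rescaling by the product `ε` of these corrections turns reindexing along `φ`
  -- into a chain map.
  let σ : U → F := fun u => (-1) ^ (T.filter (· < e u)).card
  have hσ : ∀ u, σ u * σ u = 1 := fun u => neg_one_pow_mul_self _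
  let ε : Finset U → F := fun J' => ∏ u ∈ J', σ u
  have hε : ∀ J', ε J' * ε J' = 1 := by
    intro J'
    rw [← Finset.prod_mul_distrib]
    exact Finset.prod_eq_one fun u _ => hσ u
  have hsign : ∀ (J' : Finset U) (u : U), (-1 : F) ^ ((φ J').filter (· < e u)).card =
      (-1) ^ (J'.filter (· < u)).card * σ u := by
    intro J' u
    rw [← pow_add]
    congr 1
    rw [Finset.filter_union, Finset.card_union_of_disjoint
      (Finset.disjoint_filter_filter (hdisj J')), Finset.filter_map, Finset.card_map]
    congr 2
    ext w
    simp
  let θ : (Finset V → F) →ₗ[F] (Finset U → F) :=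
    LinearMap.pi fun J' => ε J' • LinearMap.proj (φ J')
  have hθ : ∀ c J', θ c J' = ε J' * c (φ J') := fun c J' => rfl
  refine relBetti_eq_of_chainIso T.card θ ?_ ?_ ?_ ?_ i
  · intro i c hc J' hJ'
    obtain ⟨h1, h2⟩ := hc _ (right_ne_zero_of_mul hJ')
    rw [hcard] at h2
    exact ⟨hφQ.1 h1, by omega⟩
  · intro c hc h0
    ext J
    by_contra hJ
    obtain ⟨J', -, rfl⟩ := (hQ J).1 (hc J hJ)
    have h1 := congrFun h0 J'
    rw [hθ, Pi.zero_apply, mul_eq_zero] at h1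
    rcases h1 with h1 | h1
    · have := hε J'
      simp [h1] at this
    · exact hJ h1
  · intro i y hy
    refine ⟨Function.extend φ (fun J' => ε J' * y J') 0, ?_, ?_⟩
    · intro J hJ
      by_cases h : ∃ J', φ J' = J
      · obtain ⟨J', rfl⟩ := h
        rw [hφ.extend_apply] at hJ
        obtain ⟨h1, h2⟩ := hy _ (right_ne_zero_of_mul hJ)
        exact ⟨hφQ.2 h1, by rw [hcard, h2]⟩
      · rw [Function.extend_apply' _ _ _ h] at hJ
        exact absurd rfl hJ
    · ext J'
      rw [hθ, hφ.extend_apply, ← mul_assoc, hε, one_mul]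
  · intro i c hc
    ext J'
    rw [hθ]
    by_cases hJ' : J' ∈ Q'
    · rw [relD_apply_of_mem _ hJ', relD_apply_of_mem _ (hφQ.2 hJ'), Finset.mul_sum]
      symm
      refine Finset.sum_of_injOn e e.injective.injOn ?_ ?_ ?_
      · intro u hu
        simp only [Finset.coe_compl, Set.mem_compl_iff, Finset.mem_coe] at hu ⊢
        simp only [φ, Finset.mem_union, not_or]
        refine ⟨fun h => hu ?_, hT u⟩
        simpa using h
      · intro x hx hxr
        -- A nonzero value would put `insert x (φ J')` in `Q`, hence in the image of `φ`, forcing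
        -- `x` into the range of `e` or into `T`.
        have : c (insert x (φ J')) = 0 := by
          by_contra hne
          obtain ⟨J₁, -, h⟩ := (hQ _).1 (hc _ hne).1
          have hxm : x ∈ J₁.map e.toEmbedding ∪ T := by
            rw [h]
            exact Finset.mem_insert_self _ _
          have hxφ : x ∉ φ J' := Finset.mem_compl.1 hx
          rcases Finset.mem_union.1 hxm with h' | h'
          · obtain ⟨u, -, rfl⟩ := Finset.mem_map.1 h'
            refine hxr ⟨u, ?_, rfl⟩
            simp only [Finset.coe_compl, Set.mem_compl_iff, Finset.mem_coe]
            exact fun hu => hxφ (Finset.mem_union_left _ (Finset.mem_map_of_mem _ hu))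
          · exact hxφ (Finset.mem_union_right _ h')
        rw [this, mul_zero, mul_zero]
      · intro u hu
        have h1 : insert (e u) (φ J') = φ (insert u J') := by
          simp only [φ, Finset.map_insert, Finset.insert_union]
          rfl
        have h2 : ε (insert u J') = σ u * ε J' := Finset.prod_insert (Finset.mem_compl.1 hu)
        rw [hθ, h1, hsign, h2]
        ring
    · rw [relD_apply_of_notMem _ hJ', relD_apply_of_notMem _ (fun h => hJ' (hφQ.1 h)), mul_zero]

end Transfer

/-! ### The mapping cone sequence of a vertex -/

section Splitting

variable {V : Type*} [Fintype V] [LinearOrder V] {F : Type*} [Field F]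

/-- The complements in `W` of the members of `P` contained in `W`. -/
def complFamily (P : Set (Finset V)) (W : Finset V) : Set (Finset V) :=
  {J | J ⊆ W ∧ W \ J ∈ P}

/-- Splitting the members of `P` according to whether they contain the vertex `v`. -/
theorem relBetti_complFamily_le {P P₁ : Set (Finset V)} (v : V)
    (hP₁ : ∀ τ, v ∉ τ → (τ ∈ P₁ ↔ insert v τ ∈ P)) (hP : IsLowerSet P)
    {W : Finset V} (hv : v ∉ W) (i : ℕ) :
    relBetti F (complFamily P₁ W) i ≤
      relBetti F (complFamily P W) i + relBetti F (complFamily P (insert v W)) i := by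
  classical
  -- When `P` is a complex and `P₁` the link of `v`, these are the strands of `K` on `W`, of the
  -- link on `W`, and of `K` on `W ∪ {v}`. The members of `C` without `v` form `B`, and those with
  -- `v` correspond to `A`: so `C` is the cone of the restriction `A → B`.
  set A := complFamily P W with hA
  set B := complFamily P₁ W with hB
  set C := complFamily P (insert v W) with hC
  have hvJ : ∀ {J : Finset V}, J ⊆ W → v ∉ J := fun h h' => hv (h h')
  have hBA : B ⊆ A := by
    rintro J ⟨hJ, h⟩
    rw [hP₁ _ (hvJ Finset.sdiff_subset)] at h
    exact ⟨hJ, hP (Finset.subset_insert _ _) h⟩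
  have hBC : ∀ {J}, v ∉ J → (J ∈ C ↔ J ∈ B) := by
    intro J hJ
    have h1 : J ⊆ insert v W ↔ J ⊆ W := by
      rw [Finset.subset_insert_iff_of_notMem hJ]
    simp only [hB, hC, complFamily, Set.mem_ofPred_eq, h1, hP₁ _ (hvJ (Finset.sdiff_subset (t := J))),
      Finset.insert_sdiff_of_notMem _ hJ]
  have hAC : ∀ {J}, v ∉ J → (insert v J ∈ C ↔ J ∈ A) := by
    intro J hJ
    have h1 : insert v J ⊆ insert v W ↔ J ⊆ W := Finset.insert_subset_insert_iff hJ
    have h2 : insert v W \ insert v J = W \ J := by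
      rw [Finset.insert_sdiff_insert, Finset.sdiff_insert_of_notMem hv]
    simp only [hA, hC, complFamily, Set.mem_ofPred_eq, h1, h2]
  have hAv : ∀ {J}, J ∈ A → v ∉ J := fun h => hvJ h.1
  -- Enlarging `J` shrinks `W \ J`, so `B` is closed under insertions inside `A`. This makes the
  -- restriction `f` commute with the differentials.
  have hBup : ∀ {J x}, J ∈ B → insert x J ∈ A → insert x J ∈ B := by
    rintro J x ⟨hJ, h⟩ ⟨hxJ, -⟩
    refine ⟨hxJ, ?_⟩
    rw [hP₁ _ (hvJ Finset.sdiff_subset)] at h ⊢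
    exact hP (Finset.insert_subset_insert _ (Finset.sdiff_subset_sdiff subset_rfl
      (Finset.subset_insert _ _))) h
  let f : (Finset V → F) →ₗ[F] (Finset V → F) :=
    LinearMap.pi fun J => (if J ∈ B then 1 else 0 : F) • LinearMap.proj J
  have hf : ∀ c J, f c J = if J ∈ B then c J else 0 := by
    intro c J
    change (if J ∈ B then 1 else 0 : F) * c J = _
    simp
  have hfC : ∀ k, ∀ c ∈ relChains F A k, f c ∈ relChains F B k := by
    intro k c hc J hJ
    rw [hf] at hJ
    split_ifs at hJ with h
    · exact ⟨h, (hc J hJ).2⟩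
    · exact absurd rfl hJ
  have hfd : ∀ k, ∀ c ∈ relChains F A k, relD F B (f c) = f (relD F A c) := by
    intro k c hc
    ext J
    rw [hf]
    split_ifs with hJ
    · rw [relD_apply_of_mem _ hJ, relD_apply_of_mem _ (hBA hJ)]
      refine Finset.sum_congr rfl fun x _ => ?_
      rw [hf]
      split_ifs with h
      · rfl
      · by_cases h0 : c (insert x J) = 0
        · rw [h0]
        · exact absurd (hBup hJ (hc _ h0).1) h
    · rw [relD_apply_of_notMem _ hJ]
  have hgC : ∀ k, ∀ c ∈ relChains F B k, c ∈ relChains F C k := by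
    intro k c hc J hJ
    exact ⟨(hBC (hAv (hBA (hc J hJ).1))).2 (hc J hJ).1, (hc J hJ).2⟩
  have hgd : ∀ k, ∀ c ∈ relChains F B k, relD F C c = relD F B c := by
    intro k c hc
    ext J
    by_cases hv : v ∈ J
    · rw [relD_apply_of_notMem (Q := B) _ (fun h => hAv (hBA h) hv)]
      by_cases hJ : J ∈ C
      · rw [relD_apply_of_mem _ hJ]
        refine Finset.sum_eq_zero fun x _ => ?_
        have : c (insert x J) = 0 := by
          by_contra h
          exact hAv (hBA (hc _ h).1) (Finset.mem_insert_of_mem hv)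
        rw [this, mul_zero]
      · rw [relD_apply_of_notMem _ hJ]
    · by_cases hJ : J ∈ B
      · rw [relD_apply_of_mem _ hJ, relD_apply_of_mem _ ((hBC hv).2 hJ)]
      · rw [relD_apply_of_notMem _ hJ, relD_apply_of_notMem _ (fun h => hJ ((hBC hv).1 h))]
  refine finrank_subquotient_le_add _ _ _ _ _ _ f LinearMap.id ?_ ?_ ?_ ?_ ?_
  · rintro z ⟨hz, hzc⟩
    refine mem_relCycles.2 ⟨?_, hfC i z hzc⟩
    rw [hfd i z hzc, show relD F A z = 0 from hz, map_zero]
  · rintro _ ⟨w, hw, rfl⟩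
    exact ⟨f w, hfC _ w hw, hfd _ w hw⟩
  · rintro z ⟨hz, hzc⟩
    exact mem_relCycles.2 ⟨(hgd i z hzc).trans hz, hgC i z hzc⟩
  · rintro _ ⟨w, hw, rfl⟩
    exact ⟨w, hgC _ w hw, hgd _ w hw⟩
  · rintro z ⟨-, hzc⟩ ⟨w, hw, hwz⟩
    rw [LinearMap.id_apply] at hwz
    -- Exactness at `B`: write `w` as its `u_v`-part `a`, signed, plus its part `w₀` free of `u_v`.
    -- As `z` vanishes on sets containing `v`, comparing `d w = z` on sets with `v` shows that `a`
    -- is a cycle, and on sets without `v` that `z = f a + d w₀`.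
    let a : Finset V → F := fun J =>
      if v ∈ J then 0 else (-1) ^ (J.filter (· < v)).card * w (insert v J)
    have haC : a ∈ relChains F A i := by
      intro J hJ
      by_cases hvJ : v ∈ J
      · exact absurd (if_pos hvJ) hJ
      · simp only [a, if_neg hvJ] at hJ
        obtain ⟨h1, h2⟩ := hw _ (right_ne_zero_of_mul hJ)
        rw [Finset.card_insert_of_notMem hvJ] at h2
        exact ⟨(hAC hvJ).1 h1, by omega⟩
    let w₀ : Finset V → F := fun J => if v ∈ J then 0 else w J
    have hw₀ : w₀ ∈ relChains F B (i + 1) := by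
      intro J hJ
      by_cases hvJ : v ∈ J
      · exact absurd (if_pos hvJ) hJ
      · simp only [w₀, if_neg hvJ] at hJ
        exact ⟨(hBC hvJ).1 (hw _ hJ).1, (hw _ hJ).2⟩
    refine ⟨a, mem_relCycles.2 ⟨?_, haC⟩, w₀, hw₀, ?_⟩
    · ext J
      by_cases hJ : J ∈ A
      swap
      · rw [relD_apply_of_notMem _ hJ, Pi.zero_apply]
      have hvJ := hAv hJ
      have key := congrFun hwz (insert v J)
      have hz0 : z (insert v J) = 0 := by
        by_contra h
        exact hAv (hBA (hzc _ h).1) (Finset.mem_insert_self _ _)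
      rw [relD_apply_of_mem _ ((hAC hvJ).2 hJ), hz0] at key
      rw [relD_apply_of_mem _ hJ, Pi.zero_apply,
        ← Finset.insert_erase (Finset.mem_compl.2 hvJ),
        Finset.sum_insert (Finset.notMem_erase _ _), ← Finset.compl_insert]
      have h1 : a (insert v J) = 0 := if_pos (Finset.mem_insert_self _ _)
      rw [h1, mul_zero, zero_add]
      have h2 : ∑ x ∈ (insert v J)ᶜ, (-1) ^ (J.filter (· < x)).card * a (insert x J) =
          -((-1) ^ (J.filter (· < v)).card * ∑ x ∈ (insert v J)ᶜ,
            (-1) ^ ((insert v J).filter (· < x)).card * w (insert x (insert v J))) := by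
        rw [Finset.mul_sum, ← Finset.sum_neg_distrib]
        refine Finset.sum_congr rfl fun x hx => ?_
        simp only [Finset.mem_compl, Finset.mem_insert, not_or] at hx
        have hs := koszulSign_swap (F := F) J hvJ hx.2 (Ne.symm hx.1)
        have hs2 : ((-1 : F) ^ (J.filter (· < x)).card) *
            (-1) ^ ((insert x J).filter (· < v)).card =
            -((-1) ^ (J.filter (· < v)).card * (-1) ^ ((insert v J).filter (· < x)).card) := by
          have e1 := neg_one_pow_mul_self (F := F) (J.filter (· < x)).card
          have e2 := neg_one_pow_mul_self (F := F) ((insert v J).filter (· < x)).card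
          linear_combination (-1 : F) ^ (J.filter (· < x)).card *
            (-1) ^ ((insert v J).filter (· < x)).card * hs -
            (-1) ^ (J.filter (· < x)).card * (-1) ^ ((insert x J).filter (· < v)).card * e2 -
            (-1) ^ ((insert v J).filter (· < x)).card * (-1) ^ (J.filter (· < v)).card * e1
        simp only [a]
        rw [if_neg (by simp [hvJ, Ne.symm hx.1]), Finset.insert_comm v x J, ← mul_assoc, hs2]
        ring
      rw [h2, key, mul_zero, neg_zero]
    · ext J
      rw [Pi.sub_apply, hf]
      by_cases hJ : J ∈ B
      · have hvJ := hAv (hBA hJ)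
        rw [if_pos hJ, ← hwz, relD_apply_of_mem _ hJ, relD_apply_of_mem _ ((hBC hvJ).2 hJ),
          ← Finset.insert_erase (Finset.mem_compl.2 hvJ),
          Finset.sum_insert (Finset.notMem_erase _ _),
          Finset.sum_insert (Finset.notMem_erase _ _), ← Finset.compl_insert]
        have h1 : w₀ (insert v J) = 0 := if_pos (Finset.mem_insert_self _ _)
        have h2 : a J = (-1) ^ (J.filter (· < v)).card * w (insert v J) := if_neg hvJ
        rw [h1, h2, mul_zero, zero_add, add_sub_cancel_left]
        refine Finset.sum_congr rfl fun x hx => ?_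
        simp only [Finset.mem_compl, Finset.mem_insert, not_or] at hx
        have h3 : w₀ (insert x J) = w (insert x J) := if_neg (by simp [hvJ, Ne.symm hx.1])
        rw [h3]
      · rw [if_neg hJ, relD_apply_of_notMem _ hJ, sub_zero]
        by_contra h
        exact hJ (hzc J (Ne.symm h)).1

end Splitting

/-! ### Monomial coefficients in the Stanley–Reisner ring -/

section Coefficients

variable {V : Type*} [LinearOrder V]

/-- The exponent vector of the squarefree monomial with support `J`. -/
noncomputable def indic (J : Finset V) : V →₀ ℕ := ∑ x ∈ J, Finsupp.single x 1

theorem indic_apply (J : Finset V) (x : V) : indic J x = if x ∈ J then 1 else 0 := by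
  simp [indic, Finsupp.finsetSum_apply, Finsupp.single_apply]

theorem indic_insert {J : Finset V} {x : V} (hx : x ∉ J) :
    indic (insert x J) = indic J + Finsupp.single x 1 := by
  rw [indic, Finset.sum_insert hx, add_comm, indic]

theorem degree_indic (J : Finset V) : (indic J).degree = J.card := by
  simp [indic, map_sum]

theorem support_indic (J : Finset V) : (indic J).support = J := by
  ext x
  simp [indic_apply]

variable (F : Type*) [Field F] (K : AbstractSimplicialComplex V)

theorem isLowerSet_simplices : IsLowerSet (simplices K) := by
  rintro τ ρ hρ (rfl | hτ)
  · exact Or.inl (Finset.subset_empty.1 hρ)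
  · rcases ρ.eq_empty_or_nonempty with h | h
    · exact Or.inl h
    · exact Or.inr ((K.isRelLowerSet_faces hτ).2 hρ h)

/-- The ideal is monomial, so membership is tested on each monomial. Since non-simplices are closed
under enlargement, `v^b` is divisible by a generator exactly when the squarefree monomial on its own
support is one. -/
theorem mem_srIdeal {p : MvPolynomial V F} :
    p ∈ srIdeal F K ↔ ∀ b ∈ p.support, b.support ∉ simplices K := by
  have : {p : MvPolynomial V F | ∃ σ : Finset V, σ ∉ simplices K ∧
      p = ∏ x ∈ σ, MvPolynomial.X x} =
      (fun s => MvPolynomial.monomial s 1) '' (indic '' {σ | σ ∉ simplices K}) := by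
    ext p
    simp only [Set.mem_ofPred_eq, Set.mem_image, exists_exists_and_eq_and]
    refine exists_congr fun σ => and_congr_right fun _ => ?_
    rw [indic, MvPolynomial.monomial_sum_one, eq_comm]
    rfl
  rw [srIdeal, this, MvPolynomial.mem_ideal_span_monomial_image]
  refine forall₂_congr fun b _ => ?_
  constructor
  · rintro ⟨_, ⟨σ, hσ, rfl⟩, hb⟩ h
    refine hσ (isLowerSet_simplices K ?_ h)
    rw [← support_indic σ]
    exact Finsupp.support_mono hb
  · intro h
    refine ⟨_, ⟨b.support, h, rfl⟩, fun x => ?_⟩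
    rw [indic_apply]
    split_ifs with hx
    · exact Nat.one_le_iff_ne_zero.2 (Finsupp.mem_support_iff.1 hx)
    · exact zero_le

open Classical in
/-- The coefficient of the monomial with exponent `b` in an element of the Stanley–Reisner ring
(zero if the monomial vanishes there). -/
noncomputable def srCoeff (b : V →₀ ℕ) : SRRing F K →ₗ[F] F :=
  if h : b.support ∈ simplices K then
    (((srIdeal F K).restrictScalars F).liftQ (MvPolynomial.lcoeff F b) fun p hp => by
      by_contra hne
      exact (mem_srIdeal F K).1 hp b (MvPolynomial.mem_support_iff.2 hne) h) ∘ₗ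
    (Submodule.Quotient.restrictScalarsEquiv F (srIdeal F K)).symm.toLinearMap
  else 0

variable {F K}

theorem srCoeff_mk {b : V →₀ ℕ} (h : b.support ∈ simplices K) (p : MvPolynomial V F) :
    srCoeff F K b (Ideal.Quotient.mk (srIdeal F K) p) = MvPolynomial.coeff b p := by
  rw [srCoeff, dif_pos h]
  rfl

theorem srCoeff_of_notMem {b : V →₀ ℕ} (h : b.support ∉ simplices K) (f : SRRing F K) :
    srCoeff F K b f = 0 := by
  rw [srCoeff, dif_neg h]
  rfl

theorem eq_zero_of_srCoeff {f : SRRing F K} (h : ∀ b, srCoeff F K b f = 0) : f = 0 := by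
  obtain ⟨p, rfl⟩ := Ideal.Quotient.mk_surjective f
  rw [Ideal.Quotient.eq_zero_iff_mem, mem_srIdeal]
  intro b hb hK
  rw [MvPolynomial.mem_support_iff, ← srCoeff_mk hK, h] at hb
  exact hb rfl

theorem srCoeff_sign_mul_X_smul {b : V →₀ ℕ} (h : b.support ∈ simplices K) (n : ℕ) (x : V)
    (f : SRRing F K) :
    srCoeff F K b (((-1 : MvPolynomial V F) ^ n * MvPolynomial.X x) • f) =
      (-1) ^ n * if x ∈ b.support then srCoeff F K (b - Finsupp.single x 1) f else 0 := by
  obtain ⟨p, rfl⟩ := Ideal.Quotient.mk_surjective f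
  have h1 : ((-1 : MvPolynomial V F) ^ n * MvPolynomial.X x) • Ideal.Quotient.mk (srIdeal F K) p =
      Ideal.Quotient.mk (srIdeal F K) (MvPolynomial.C ((-1) ^ n) * (MvPolynomial.X x * p)) := by
    rw [← mul_assoc, map_pow, map_neg, map_one]
    rfl
  rw [h1, srCoeff_mk h, MvPolynomial.coeff_C_mul, MvPolynomial.coeff_X_mul', srCoeff_mk]
  exact isLowerSet_simplices K (Finsupp.support_mono tsub_le_self) h

theorem degree_of_srCoeff_ne_zero {n : ℕ} {f : SRRing F K} (hf : f ∈ srPart F K n) {b : V →₀ ℕ}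
    (hb : srCoeff F K b f ≠ 0) : b.degree = n := by
  obtain ⟨p, hp, rfl⟩ := hf
  have h : b.support ∈ simplices K := by
    by_contra h
    exact hb (srCoeff_of_notMem h _)
  by_contra hne
  refine hb ((srCoeff_mk h p).trans ?_)
  exact MvPolynomial.IsHomogeneous.coeff_eq_zero hp hne

theorem mk_monomial_mem_srPart (b : V →₀ ℕ) (r : F) :
    Ideal.Quotient.mk (srIdeal F K) (MvPolynomial.monomial b r) ∈ srPart F K b.degree :=
  ⟨_, MvPolynomial.isHomogeneous_monomial r rfl, rfl⟩

end Coefficients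

/-! ### Decomposition by multidegree and Hochster's formula -/

section Multidegrees

variable {V : Type*} [Fintype V] [LinearOrder V] (F : Type*) [Field F]
  (K : AbstractSimplicialComplex V)

/-- The sets `J` such that `u_J` occurs in the multidegree `a` of `F[K] ⊗ Λ[u_x : x ∈ V]`. -/
def multiFamily (a : V →₀ ℕ) : Set (Finset V) :=
  {J | indic J ≤ a ∧ (a - indic J).support ∈ simplices K}

open Classical in
/-- The component of multidegree `a` of an element of `F[K] ⊗ Λ[u_x : x ∈ V]`. -/
noncomputable def multiPart (a : V →₀ ℕ) : (Finset V → SRRing F K) →ₗ[F] (Finset V → F) :=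
  LinearMap.pi fun J =>
    if indic J ≤ a then srCoeff F K (a - indic J) ∘ₗ LinearMap.proj J else 0

variable {F K}

theorem multiPart_of_le {a : V →₀ ℕ} {J : Finset V} (h : indic J ≤ a)
    (f : Finset V → SRRing F K) : multiPart F K a f J = srCoeff F K (a - indic J) (f J) := by
  simp [multiPart, h]

theorem multiPart_of_not_le {a : V →₀ ℕ} {J : Finset V} (h : ¬ indic J ≤ a)
    (f : Finset V → SRRing F K) : multiPart F K a f J = 0 := by
  simp [multiPart, h]

theorem mem_multiFamily_of_ne_zero {a : V →₀ ℕ} {J : Finset V} {f : Finset V → SRRing F K}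
    (h : multiPart F K a f J ≠ 0) : J ∈ multiFamily K a := by
  have h1 : indic J ≤ a := by
    by_contra h1
    exact h (multiPart_of_not_le h1 f)
  rw [multiPart_of_le h1] at h
  refine ⟨h1, ?_⟩
  by_contra h2
  exact h (srCoeff_of_notMem h2 _)

theorem eq_zero_of_multiPart {f : Finset V → SRRing F K} (h : ∀ a, multiPart F K a f = 0) :
    f = 0 := by
  ext J : 1
  refine eq_zero_of_srCoeff fun b => ?_
  have := congrFun (h (b + indic J)) J
  rwa [multiPart_of_le le_add_self, add_tsub_cancel_right] at this

/-- Both `u_x` and `v_x` have multidegree `x`, so the Koszul differential preserves multidegrees.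
The term of `x` survives exactly when `v_x` divides `v^(a-J)`, that is, when `insert x J` still fits
below `a`. -/
theorem multiPart_koszulD (a : V →₀ ℕ) (f : Finset V → SRRing F K) :
    multiPart F K a (koszulD V F (SRRing F K) f) =
      relD F (multiFamily K a) (multiPart F K a f) := by
  ext J
  by_cases hJ : J ∈ multiFamily K a
  swap
  · rw [relD_apply_of_notMem _ hJ]
    by_contra h
    exact hJ (mem_multiFamily_of_ne_zero h)
  rw [relD_apply_of_mem _ hJ, multiPart_of_le hJ.1, koszulD_apply, map_sum]
  refine Finset.sum_congr rfl fun x hx => ?_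
  have hx : x ∉ J := Finset.mem_compl.1 hx
  rw [srCoeff_sign_mul_X_smul hJ.2]
  congr 1
  have hle : indic (insert x J) ≤ a ↔ x ∈ (a - indic J).support := by
    rw [indic_insert hx, ← le_tsub_iff_left hJ.1, Finsupp.single_le_iff, Finsupp.mem_support_iff,
      Nat.one_le_iff_ne_zero]
  split_ifs with h
  · rw [multiPart_of_le (hle.2 h), indic_insert hx, tsub_tsub]
  · rw [multiPart_of_not_le fun h' => h (hle.1 h')]

theorem mem_koszulPart {i j : ℕ} {f : Finset V → SRRing F K} :
    f ∈ koszulPart V (srPart F K) i j ↔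
      ∀ J, f J ∈ (if J.card = i ∧ i ≤ j then srPart F K (j - i) else ⊥) := by
  simp [koszulPart, Submodule.mem_pi]

theorem card_degree_of_multiPart_ne_zero {i j : ℕ} {f : Finset V → SRRing F K}
    (hf : f ∈ koszulPart V (srPart F K) i j) {a : V →₀ ℕ} {J : Finset V}
    (h : multiPart F K a f J ≠ 0) : J.card = i ∧ a.degree = j := by
  have hJ := mem_multiFamily_of_ne_zero h
  have hfJ := mem_koszulPart.1 hf J
  rw [multiPart_of_le hJ.1] at h
  split_ifs at hfJ with hc
  · refine ⟨hc.1, ?_⟩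
    have h1 := degree_of_srCoeff_ne_zero hfJ h
    have h2 : a.degree = (a - indic J).degree + (indic J).degree := by
      rw [← map_add, tsub_add_cancel_of_le hJ.1]
    rw [h1, degree_indic, hc.1] at h2
    omega
  · rw [(Submodule.mem_bot F).1 hfJ, map_zero] at h
    exact absurd rfl h

theorem multiPart_mem_relChains {i j : ℕ} {f : Finset V → SRRing F K}
    (hf : f ∈ koszulPart V (srPart F K) i j) (a : V →₀ ℕ) :
    multiPart F K a f ∈ relChains F (multiFamily K a) i := fun _ hJ =>
  ⟨mem_multiFamily_of_ne_zero hJ, (card_degree_of_multiPart_ne_zero hf hJ).1⟩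

theorem multiPart_eq_zero_of_degree_ne {i j : ℕ} {f : Finset V → SRRing F K}
    (hf : f ∈ koszulPart V (srPart F K) i j) {a : V →₀ ℕ} (ha : a.degree ≠ j) :
    multiPart F K a f = 0 := by
  ext J
  by_contra h
  exact ha (card_degree_of_multiPart_ne_zero hf h).2

/-- Elements of bidegree `(i, j)` may be prescribed on each multidegree of total degree `j`. -/
theorem exists_multiPart_eq {i j : ℕ} (s : Finset (V →₀ ℕ)) (hs : ∀ a ∈ s, a.degree = j)
    (c : (V →₀ ℕ) → Finset V → F) (hc : ∀ a ∈ s, c a ∈ relChains F (multiFamily K a) i) :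
    ∃ f ∈ koszulPart V (srPart F K) i j, ∀ a ∈ s, multiPart F K a f = c a := by
  refine ⟨fun J => Ideal.Quotient.mk (srIdeal F K)
    (∑ a ∈ s, MvPolynomial.monomial (a - indic J) (c a J)), ?_, ?_⟩
  · refine mem_koszulPart.2 fun J => ?_
    rw [map_sum]
    refine Submodule.sum_mem _ fun a ha => ?_
    by_cases h : c a J = 0
    · rw [h, map_zero, map_zero]
      exact zero_mem _
    · obtain ⟨h1, rfl⟩ := hc a ha J h
      have h2 : j = (a - indic J).degree + J.card := by
        rw [← hs a ha, ← degree_indic J, ← map_add, tsub_add_cancel_of_le h1.1]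
      rw [if_pos ⟨rfl, by omega⟩, h2, Nat.add_sub_cancel]
      exact mk_monomial_mem_srPart _ _
  · intro a ha
    ext J
    by_cases hJ : J ∈ multiFamily K a
    · rw [multiPart_of_le hJ.1, srCoeff_mk hJ.2, MvPolynomial.coeff_sum,
        Finset.sum_eq_single_of_mem a ha]
      · rw [MvPolynomial.coeff_monomial, if_pos rfl]
      -- For fixed `J` the exponent `a - J` determines `a`, so distinct multidegrees do not
      -- interfere.
      · intro a' ha' hne
        rw [MvPolynomial.coeff_monomial]
        split_ifs with h
        · by_contra h0
          have h1 := (hc a' ha' J h0).1.1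
          apply hne
          rw [← tsub_add_cancel_of_le h1, h, tsub_add_cancel_of_le hJ.1]
        · rfl
    · have h1 : c a J = 0 := by
        by_contra h
        exact hJ (hc a ha J h).1
      rw [h1]
      by_contra h
      exact hJ (mem_multiFamily_of_ne_zero h)

theorem mem_finsuppAntidiag_univ {a : V →₀ ℕ} {j : ℕ} :
    a ∈ (Finset.univ : Finset V).finsuppAntidiag j ↔ a.degree = j := by
  simp [Finset.mem_finsuppAntidiag, Finsupp.degree_eq_sum]

/-- The part of internal degree `j` is the direct sum of the finitely many multidegrees of total
degree `j`, and taking homology respects this sum. -/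
theorem bigradedBetti_eq_sum_multidegrees (i j : ℕ) :
    bigradedBetti F K i j = ∑ a ∈ (Finset.univ : Finset V).finsuppAntidiag j,
      relBetti F (multiFamily K a) i := by
  classical
  set s := (Finset.univ : Finset V).finsuppAntidiag j with hs
  have hsd : ∀ a, a ∈ s ↔ a.degree = j := fun a => mem_finsuppAntidiag_univ
  rw [← Finset.sum_coe_sort]
  have hext : ∀ k, ∀ c : s → Finset V → F, (∀ a : s, c a ∈ relChains F (multiFamily K a) k) →
      ∃ f ∈ koszulPart V (srPart F K) k j, ∀ a : s, multiPart F K a f = c a := by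
    intro k c hc
    obtain ⟨f, hf, h⟩ := exists_multiPart_eq (K := K) (i := k) s (fun a => (hsd a).1)
      (fun a => if h : a ∈ s then c ⟨a, h⟩ else 0) (fun a ha => by
        rw [dif_pos ha]
        exact hc ⟨a, ha⟩)
    exact ⟨f, hf, fun a => by rw [h a a.2, dif_pos a.2]⟩
  refine finrank_subquotient_eq_sum _ _ (fun a : s => relCycles F (multiFamily K a) i)
    (fun a => relBoundaries F (multiFamily K a) i) (fun a => multiPart F K a) ?_ ?_ ?_
  · rintro z ⟨hz, hzp⟩ a
    refine mem_relCycles.2 ⟨?_, multiPart_mem_relChains hzp _⟩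
    rw [← multiPart_koszulD, show koszulD V F (SRRing F K) z = 0 from hz, map_zero]
  · rintro z ⟨-, hzp⟩
    constructor
    · rintro ⟨w, hw, rfl⟩ a
      exact ⟨_, multiPart_mem_relChains hw a, (multiPart_koszulD _ _).symm⟩
    · intro h
      choose w hw hwz using fun a => mem_relBoundaries.1 (h a)
      obtain ⟨f, hf, hfw⟩ := hext _ w hw
      refine ⟨f, hf, sub_eq_zero.1 (eq_zero_of_multiPart fun a => ?_)⟩
      rw [map_sub]
      refine sub_eq_zero.2 ((multiPart_koszulD a f).trans ?_)
      by_cases ha : a ∈ s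
      · rw [hfw ⟨a, ha⟩]
        exact hwz ⟨a, ha⟩
      · rw [hsd] at ha
        rw [multiPart_eq_zero_of_degree_ne hf ha, multiPart_eq_zero_of_degree_ne hzp ha, map_zero]
  · intro y hy
    obtain ⟨f, hf, hfy⟩ := hext _ y fun a => (hy a).2
    refine ⟨f, ⟨?_, hf⟩, hfy⟩
    refine eq_zero_of_multiPart fun a => (multiPart_koszulD a f).trans ?_
    by_cases ha : a ∈ s
    · rw [hfy ⟨a, ha⟩]
      exact (hy ⟨a, ha⟩).1
    · rw [hsd] at ha
      rw [multiPart_eq_zero_of_degree_ne hf ha, map_zero]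

theorem indic_le_iff {J : Finset V} {a : V →₀ ℕ} : indic J ≤ a ↔ J ⊆ a.support := by
  rw [Finsupp.le_def]
  constructor
  · intro h x hx
    have := h x
    rw [indic_apply, if_pos hx] at this
    exact Finsupp.mem_support_iff.2 (by omega)
  · intro h x
    rw [indic_apply]
    split_ifs with hx
    · exact Nat.one_le_iff_ne_zero.2 (Finsupp.mem_support_iff.1 (h hx))
    · exact zero_le

theorem multiFamily_indic (W : Finset V) :
    multiFamily K (indic W) = complFamily (simplices K) W := by
  ext J
  have : (indic W - indic J).support = W \ J := by
    ext x
    simp only [Finsupp.mem_support_iff, Finsupp.tsub_apply, indic_apply, Finset.mem_sdiff]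
    split_ifs <;> simp_all
  simp only [multiFamily, complFamily, Set.mem_ofPred_eq, this, indic_le_iff, support_indic]

/-- When `a x ≥ 2`, the variable `v_x` divides the coefficient monomial whether or not `u_x` is
present, so `x` is a cone vertex of the family. -/
theorem relBetti_multiFamily_eq_zero {a : V →₀ ℕ} {x : V} (hx : 2 ≤ a x) (i : ℕ) :
    relBetti F (multiFamily K a) i = 0 := by
  refine relBetti_eq_zero_of_cone x (fun J hJ => ?_) i
  have h1 : (a - indic (insert x J)).support = (a - indic J).support := by
    ext y
    simp only [Finsupp.mem_support_iff, Finsupp.tsub_apply, indic_apply, Finset.mem_insert]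
    by_cases hy : y = x
    · subst hy
      simp only [hJ, or_false, if_true, if_false]
      omega
    · simp [hy]
  simp only [multiFamily, Set.mem_ofPred_eq, h1, indic_le_iff, Finset.insert_subset_iff,
    Finsupp.mem_support_iff]
  have : a x ≠ 0 := by omega
  simp [this]

/-- **Hochster's formula**: only squarefree multidegrees contribute to the Betti numbers. -/
theorem bigradedBetti_eq_sum_complFamily (i j : ℕ) :
    bigradedBetti F K i j = ∑ W ∈ Finset.univ.powersetCard j,
      relBetti F (complFamily (simplices K) W) i := by
  rw [bigradedBetti_eq_sum_multidegrees]
  symm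
  refine Finset.sum_of_injOn indic ?_ ?_ ?_ ?_
  · intro W _ W' _ h
    rw [← support_indic W, h, support_indic]
  · intro W hW
    rw [Finset.mem_coe, mem_finsuppAntidiag_univ, degree_indic]
    exact (Finset.mem_powersetCard.1 (Finset.mem_coe.1 hW)).2
  · intro a ha hna
    -- An exponent vector with all entries at most 1 is the indicator of its support.
    have : ∃ x, 2 ≤ a x := by
      by_contra! h
      have h1 : indic a.support = a := by
        ext x
        have := h x
        simp only [indic_apply, Finsupp.mem_support_iff]
        split_ifs <;> omega
      refine hna ⟨a.support, ?_, h1⟩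
      rw [Finset.mem_coe, Finset.mem_powersetCard]
      refine ⟨Finset.subset_univ _, ?_⟩
      rw [← degree_indic, h1, ← mem_finsuppAntidiag_univ]
      exact ha
    obtain ⟨x, hx⟩ := this
    exact relBetti_multiFamily_eq_zero hx i
  · intro W _
    rw [multiFamily_indic]

end Multidegrees

/-! ### Deletion, link and inequality (a) -/

section Vertices

variable {V : Type*} [Fintype V] [LinearOrder V] {U : Type*} [Fintype U] [LinearOrder U]
  {F : Type*} [Field F]

/-- The elements of `T` are ghost vertices: no member of `P` meets `T`, so every `J` in the family
must contain `T`, which only shifts the degree. -/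
theorem relBetti_complFamily_map_union (e : U ↪o V) (T : Finset V) (hT : ∀ u, e u ∉ T)
    {P' : Set (Finset U)} {P : Set (Finset V)} (hP : ∀ τ ∈ P, Disjoint τ T)
    (hP' : ∀ τ, τ.map e.toEmbedding ∈ P ↔ τ ∈ P') (W : Finset U) (i : ℕ) :
    relBetti F (complFamily P (W.map e.toEmbedding ∪ T)) (i + T.card) =
      relBetti F (complFamily P' W) i := by
  have hsd : ∀ J : Finset U, (W.map e.toEmbedding ∪ T) \ (J.map e.toEmbedding ∪ T) =
      (W \ J).map e.toEmbedding := by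
    intro J
    ext x
    simp only [Finset.mem_sdiff, Finset.mem_union, Finset.mem_map]
    constructor
    · rintro ⟨⟨u, hu, rfl⟩ | h, h2⟩
      · exact ⟨u, ⟨hu, fun h => h2 (Or.inl ⟨u, h, rfl⟩)⟩, rfl⟩
      · exact absurd (Or.inr h) h2
    · rintro ⟨u, ⟨hu, hJ⟩, rfl⟩
      refine ⟨Or.inl ⟨u, hu, rfl⟩, ?_⟩
      rintro (⟨u', h, h'⟩ | h)
      · exact hJ (e.injective h' ▸ h)
      · exact hT u h
  refine relBetti_map_union e T hT (fun J => ?_) i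
  constructor
  · rintro ⟨hJ, hJP⟩
    have hTJ : T ⊆ J := by
      intro x hx
      by_contra hxJ
      exact Finset.disjoint_left.1 (hP _ hJP)
        (Finset.mem_sdiff.2 ⟨Finset.mem_union_right _ hx, hxJ⟩) hx
    have h1 : J \ T ⊆ W.map e.toEmbedding := by
      intro x hx
      obtain ⟨hx, hxT⟩ := Finset.mem_sdiff.1 hx
      exact (Finset.mem_union.1 (hJ hx)).resolve_right hxT
    obtain ⟨J', hJ', h2⟩ := Finset.subset_map_iff.1 h1
    have h3 : J'.map e.toEmbedding ∪ T = J := by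
      rw [← h2, Finset.sdiff_union_of_subset hTJ]
    refine ⟨J', ⟨hJ', ?_⟩, h3⟩
    rwa [← h3, hsd, hP'] at hJP
  · rintro ⟨J', ⟨hJ', h⟩, rfl⟩
    refine ⟨Finset.union_subset_union_left (Finset.map_subset_map.2 hJ'), ?_⟩
    rwa [hsd, hP']

theorem mem_simplices_iff_of_map {e : U ↪ V} {K : AbstractSimplicialComplex V}
    {K' : AbstractSimplicialComplex U} (h : ∀ τ, τ ∈ K'.faces ↔ τ.map e ∈ K.faces)
    (τ : Finset U) : τ.map e ∈ simplices K ↔ τ ∈ simplices K' := by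
  simp [simplices, h]

theorem bigradedBetti_deletion (K : AbstractSimplicialComplex V) (v : V) (i j : ℕ) :
    bigradedBetti F (deletion K v) i j = ∑ W ∈ (Finset.univ.erase v).powersetCard j,
      relBetti F (complFamily (simplices K) W) i := by
  let e : {u : V // u ≠ v} ↪o V := OrderEmbedding.subtype _
  have he : Finset.univ.map e.toEmbedding = Finset.univ.erase v := by
    ext x
    simp [e]
  rw [bigradedBetti_eq_sum_complFamily, ← he, Finset.powersetCard_map, Finset.sum_map]
  refine Finset.sum_congr rfl fun W _ => ?_
  have := relBetti_complFamily_map_union (F := F) e ∅ (by simp) (P := simplices K) (by simp)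
    (P' := simplices (deletion K v)) (mem_simplices_iff_of_map fun τ => Iff.rfl) W i
  rw [Finset.card_empty, add_zero, Finset.union_empty] at this
  exact this.symm

/-- Used with `s` the link vertices and `t` the ghost vertices; `k` counts the ghost vertices in
`W`. -/
theorem sum_powersetCard_union {α M : Type*} [DecidableEq α] [AddCommMonoid M] {s t : Finset α}
    (h : Disjoint s t) (n : ℕ) (f : Finset α → M) :
    ∑ W ∈ (s ∪ t).powersetCard n, f W = ∑ k ∈ Finset.range (n + 1),
      ∑ T ∈ t.powersetCard k, ∑ S ∈ s.powersetCard (n - k), f (S ∪ T) := by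
  simp_rw [← Finset.sum_product']
  rw [Finset.sum_sigma']
  refine Finset.sum_bij' (fun W _ => ⟨(W ∩ t).card, (W ∩ t, W ∩ s)⟩) (fun p _ => p.2.2 ∪ p.2.1)
    ?_ ?_ ?_ ?_ ?_
  · intro W hW
    obtain ⟨hW, hc⟩ := Finset.mem_powersetCard.1 hW
    have h1 : (W ∩ s).card + (W ∩ t).card = n := by
      rw [← hc, ← Finset.card_union_of_disjoint
        (h.mono Finset.inter_subset_right Finset.inter_subset_right),
        ← Finset.inter_union_distrib_left, Finset.inter_eq_left.2 hW]
    simp only [Finset.mem_sigma, Finset.mem_range, Finset.mem_product, Finset.mem_powersetCard,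
      Finset.inter_subset_right, true_and]
    omega
  · rintro ⟨k, T, S⟩ hp
    simp only [Finset.mem_sigma, Finset.mem_range, Finset.mem_product,
      Finset.mem_powersetCard] at hp ⊢
    obtain ⟨hk, ⟨hT, hTc⟩, hS, hSc⟩ := hp
    refine ⟨Finset.union_subset_union hS hT, ?_⟩
    rw [Finset.card_union_of_disjoint (h.mono hS hT)]
    omega
  · intro W hW
    obtain ⟨hW, -⟩ := Finset.mem_powersetCard.1 hW
    simp only
    rw [← Finset.inter_union_distrib_left, Finset.inter_eq_left.2 hW]
  · rintro ⟨k, T, S⟩ hp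
    simp only [Finset.mem_sigma, Finset.mem_range, Finset.mem_product,
      Finset.mem_powersetCard] at hp
    obtain ⟨hk, ⟨hT, rfl⟩, hS, hSc⟩ := hp
    have h1 : (S ∪ T) ∩ t = T := by
      rw [Finset.union_inter_distrib_right, Finset.disjoint_iff_inter_eq_empty.1 (h.mono_left hS),
        Finset.empty_union, Finset.inter_eq_left.2 hT]
    have h2 : (S ∪ T) ∩ s = S := by
      rw [Finset.union_inter_distrib_right,
        Finset.disjoint_iff_inter_eq_empty.1 (h.symm.mono_left hT), Finset.union_empty,
        Finset.inter_eq_left.2 hS]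
    simp only [h1, h2]
  · intro W hW
    obtain ⟨hW, -⟩ := Finset.mem_powersetCard.1 hW
    simp only
    rw [← Finset.inter_union_distrib_left, Finset.inter_eq_left.2 hW]

/-- The simplices of the link of `v`, as sets of vertices of `K`. -/
def linkFamily (K : AbstractSimplicialComplex V) (v : V) : Set (Finset V) :=
  {τ | v ∉ τ ∧ insert v τ ∈ simplices K}

theorem sum_relBetti_linkFamily (K : AbstractSimplicialComplex V) (v : V) (i j : ℕ) :
    ∑ W ∈ (Finset.univ.erase v).powersetCard j, relBetti F (complFamily (linkFamily K v) W) i =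
      ∑ s ∈ Finset.range (j + 1), if s ≤ i then
        (Fintype.card V - Fintype.card (LinkVertex K v) - 1).choose s *
          bigradedBetti F (link K v) (i - s) (j - s) else 0 := by
  let e : LinkVertex K v ↪o V := OrderEmbedding.subtype _
  have hev : ∀ u, e u ≠ v := fun u => u.2.1
  set L : Finset V := Finset.univ.map e.toEmbedding with hL
  have hLv : L ⊆ Finset.univ.erase v := by
    intro x hx
    obtain ⟨u, -, rfl⟩ := Finset.mem_map.1 hx
    exact Finset.mem_erase.2 ⟨hev u, Finset.mem_univ _⟩
  set G : Finset V := Finset.univ.erase v \ L with hG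
  have hLG : L ∪ G = Finset.univ.erase v := Finset.union_sdiff_of_subset hLv
  have hGc : G.card = Fintype.card V - Fintype.card (LinkVertex K v) - 1 := by
    rw [hG, Finset.card_sdiff_of_subset hLv, Finset.card_erase_of_mem (Finset.mem_univ _), hL,
      Finset.card_map, Finset.card_univ, Finset.card_univ]
    omega
  have hmem : ∀ τ ∈ linkFamily K v, τ ⊆ L := by
    rintro τ ⟨hv, hτ⟩ u hu
    have h1 : insert v τ ∈ K.faces := hτ.resolve_left (Finset.insert_ne_empty _ _)
    have h2 : ({v, u} : Finset V) ∈ K.faces := by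
      refine (K.isRelLowerSet_faces h1).2 ?_ (Finset.insert_nonempty _ _)
      exact Finset.insert_subset_insert _ (Finset.singleton_subset_iff.2 hu)
    exact Finset.mem_map.2 ⟨⟨u, fun h => hv (h ▸ hu), h2⟩, Finset.mem_univ _, rfl⟩
  have hmap : ∀ τ : Finset (LinkVertex K v),
      τ.map e.toEmbedding ∈ linkFamily K v ↔ τ ∈ simplices (link K v) := by
    intro τ
    have hv : v ∉ τ.map e.toEmbedding := by
      intro h
      obtain ⟨u, -, hu⟩ := Finset.mem_map.1 h
      exact hev u hu
    have h1 : insert v (τ.map e.toEmbedding) ∈ simplices K ↔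
        insert v (τ.map e.toEmbedding) ∈ K.faces := by
      simp [simplices]
    simp only [linkFamily, Set.mem_ofPred_eq, hv, not_false_eq_true, true_and, h1]
    -- The empty simplex is not recorded in `faces`; it corresponds to the vertex `{v}` of `K`.
    rcases τ.eq_empty_or_nonempty with rfl | hne
    · simpa [simplices] using K.singleton_mem v
    · simp only [simplices, Set.mem_ofPred_eq, hne.ne_empty, false_or]
      exact ⟨fun h => ⟨hne, h⟩, fun h => h.2⟩
  rw [← hLG, sum_powersetCard_union Finset.disjoint_sdiff]
  refine Finset.sum_congr rfl fun s _ => ?_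
  have hGL : ∀ T ∈ G.powersetCard s, Disjoint L T ∧ T.card = s := by
    intro T hT
    obtain ⟨hT, hTc⟩ := Finset.mem_powersetCard.1 hT
    exact ⟨Finset.disjoint_sdiff.mono_right hT, hTc⟩
  split_ifs with hs
  · rw [← hGc, ← Finset.card_powersetCard, ← smul_eq_mul, ← Finset.sum_const]
    refine Finset.sum_congr rfl fun T hT => ?_
    obtain ⟨hLT, hTc⟩ := hGL T hT
    rw [bigradedBetti_eq_sum_complFamily, hL, Finset.powersetCard_map, Finset.sum_map]
    refine Finset.sum_congr rfl fun W _ => ?_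
    have := relBetti_complFamily_map_union (F := F) e T
      (fun u => Finset.disjoint_left.1 hLT (Finset.mem_map_of_mem _ (Finset.mem_univ u)))
      (fun τ hτ => hLT.mono_left (hmem τ hτ)) hmap W (i - s)
    rw [hTc, Nat.sub_add_cancel hs] at this
    exact this
  -- Every `J` in the family contains the `s` ghost vertices of `T`, so none has cardinality `i <
  -- s`.
  · refine Finset.sum_eq_zero fun T hT => Finset.sum_eq_zero fun S _ => ?_
    obtain ⟨hLT, hTc⟩ := hGL T hT
    refine relBetti_eq_zero_of_card_ne ?_
    rintro J ⟨-, hJ⟩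
    have hTJ : T ⊆ J := by
      intro x hx
      by_contra hxJ
      exact Finset.disjoint_left.1 (hLT.mono_left (hmem _ hJ))
        (Finset.mem_sdiff.2 ⟨Finset.mem_union_right _ hx, hxJ⟩) hx
    have := Finset.card_le_card hTJ
    omega

theorem bigradedBetti_zero_deletion (K : AbstractSimplicialComplex V) (v : V) (i : ℕ) :
    bigradedBetti F (deletion K v) i 0 = bigradedBetti F K i 0 := by
  rw [bigradedBetti_deletion, bigradedBetti_eq_sum_complFamily, Finset.powersetCard_zero,
    Finset.powersetCard_zero]

/-- Inequality (a) with the negative term moved across, to stay within `ℕ`. The sets of size `j + 1`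
split into those avoiding `v`, counted by the deletion, and the sets `W ∪ {v}` with `|W| = j`, to
which the cone sequence applies. -/
theorem sum_link_add_deletion_le (K : AbstractSimplicialComplex V) (v : V) (i j : ℕ) :
    (∑ s ∈ Finset.range (j + 1), if s ≤ i then
        (Fintype.card V - Fintype.card (LinkVertex K v) - 1).choose s *
          bigradedBetti F (link K v) (i - s) (j - s) else 0) +
      bigradedBetti F (deletion K v) i (j + 1) ≤
    bigradedBetti F K i (j + 1) + bigradedBetti F (deletion K v) i j := by
  have hv : v ∉ (Finset.univ : Finset V).erase v := Finset.notMem_erase _ _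
  rw [← sum_relBetti_linkFamily, bigradedBetti_deletion, bigradedBetti_deletion,
    bigradedBetti_eq_sum_complFamily, ← Finset.insert_erase (Finset.mem_univ v),
    Finset.powersetCard_succ_insert hv, Finset.erase_insert hv, Finset.sum_union, Finset.sum_image,
    Nat.succ_eq_add_one]
  · have : ∑ W ∈ (Finset.univ.erase v).powersetCard j,
        relBetti F (complFamily (linkFamily K v) W) i ≤
        ∑ W ∈ (Finset.univ.erase v).powersetCard j, (relBetti F (complFamily (simplices K) W) i +
          relBetti F (complFamily (simplices K) (insert v W)) i) := by
      refine Finset.sum_le_sum fun W hW => ?_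
      exact relBetti_complFamily_le v (fun τ hτ => and_iff_right hτ) (isLowerSet_simplices K)
        (fun h => hv ((Finset.mem_powersetCard.1 hW).1 h)) i
    rw [Finset.sum_add_distrib] at this
    omega
  · intro W hW W' hW' h
    have h1 := fun h => hv ((Finset.mem_powersetCard.1 hW).1 h)
    have h2 := fun h => hv ((Finset.mem_powersetCard.1 hW').1 h)
    rw [← Finset.erase_insert h1, ← Finset.erase_insert h2, h]
  · rw [Finset.disjoint_left]
    intro W hW hW'
    obtain ⟨W', -, rfl⟩ := Finset.mem_image.1 hW'
    exact hv ((Finset.mem_powersetCard.1 hW).1 (Finset.mem_insert_self _ _))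

end Vertices

/-! ### Summation: inequalities (b) and (c) -/

section Totals

variable {V : Type*} [Fintype V] [LinearOrder V] {F : Type*} [Field F]

theorem bigradedBetti_eq_zero_of_card_lt (K : AbstractSimplicialComplex V) (i : ℕ) {j : ℕ}
    (h : Fintype.card V < j) : bigradedBetti F K i j = 0 := by
  rw [bigradedBetti_eq_sum_complFamily, Finset.powersetCard_eq_empty.2 h, Finset.sum_empty]

theorem betti_eq_sum_range (K : AbstractSimplicialComplex V) (i : ℕ) {N : ℕ}
    (h : Fintype.card V < N) : betti F K i = ∑ j ∈ Finset.range N, bigradedBetti F K i j := by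
  refine finsum_eq_sum_of_support_subset _ fun j hj => ?_
  rw [Finset.coe_range, Set.mem_Iio]
  by_contra hN
  exact hj (bigradedBetti_eq_zero_of_card_lt K i (by omega))

theorem betti_eq_zero_of_card_lt (K : AbstractSimplicialComplex V) {i : ℕ}
    (h : Fintype.card V < i) : betti F K i = 0 := by
  rw [betti_eq_sum_range K i (Nat.lt_succ_self _)]
  refine Finset.sum_eq_zero fun j _ => ?_
  rw [bigradedBetti_eq_sum_complFamily]
  refine Finset.sum_eq_zero fun W _ => relBetti_eq_zero_of_card_ne fun J _ => ?_
  have := Finset.card_le_univ J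
  omega

theorem totalBetti_eq_sum_range (K : AbstractSimplicialComplex V) {N : ℕ}
    (h : Fintype.card V < N) : totalBetti F K = ∑ i ∈ Finset.range N, betti F K i := by
  refine finsum_eq_sum_of_support_subset _ fun i hi => ?_
  rw [Finset.coe_range, Set.mem_Iio]
  by_contra hN
  exact hi (betti_eq_zero_of_card_lt K (by omega))

theorem sum_choose_mul_betti_link_le (K : AbstractSimplicialComplex V) (v : V) (i : ℕ) :
    ∑ s ∈ Finset.range (i + 1),
        (Fintype.card V - Fintype.card (LinkVertex K v) - 1).choose s *
          betti F (link K v) (i - s) ≤ betti F K i := by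
  set n := Fintype.card V - Fintype.card (LinkVertex K v) - 1
  -- Large enough that every truncated sum below, including those of length `N - s` with `s ≤ i`,
  -- contains all nonzero Betti numbers.
  let N := i + 1 + (Fintype.card V + Fintype.card (LinkVertex K v) + 1)
  have h1 : ∑ j ∈ Finset.range N, ((∑ s ∈ Finset.range (j + 1), if s ≤ i then
      n.choose s * bigradedBetti F (link K v) (i - s) (j - s) else 0) +
      bigradedBetti F (deletion K v) i (j + 1)) ≤
      ∑ j ∈ Finset.range N, (bigradedBetti F K i (j + 1) + bigradedBetti F (deletion K v) i j) :=
    Finset.sum_le_sum fun j _ => sum_link_add_deletion_le K v i j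
  rw [Finset.sum_add_distrib, Finset.sum_add_distrib] at h1
  have h2 : ∑ j ∈ Finset.range (N + 1), bigradedBetti F K i j = betti F K i :=
    (betti_eq_sum_range K i (by omega)).symm
  rw [Finset.sum_range_succ'] at h2
  -- Telescoping leaves the degree 0 term of the deletion. It equals that of `K`, since only `W = ∅`
  -- contributes there, and so supplies the term of `betti F K i` missed by the shift to `j + 1`.
  have h3 := Finset.sum_range_succ' (fun j => bigradedBetti F (deletion K v) i j) N
  rw [Finset.sum_range_succ, bigradedBetti_zero_deletion] at h3
  have h4 : ∑ s ∈ Finset.range (i + 1), n.choose s * betti F (link K v) (i - s) ≤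
      ∑ j ∈ Finset.range N, ∑ s ∈ Finset.range (j + 1), if s ≤ i then
        n.choose s * bigradedBetti F (link K v) (i - s) (j - s) else 0 := by
    rw [Finset.sum_range_diag_flip N fun s k =>
      if s ≤ i then n.choose s * bigradedBetti F (link K v) (i - s) k else 0]
    refine (Finset.sum_le_sum fun s hs => ?_).trans (Finset.sum_le_sum_of_subset
      (Finset.range_subset_range.2 (show i + 1 ≤ N by omega)))
    have hs : s ≤ i := by
      rw [Finset.mem_range] at hs
      omega
    simp only [if_pos hs]
    rw [← Finset.mul_sum, ← betti_eq_sum_range]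
    omega
  omega

theorem two_pow_mul_totalBetti_link_le (K : AbstractSimplicialComplex V) (v : V) :
    2 ^ (Fintype.card V - Fintype.card (LinkVertex K v) - 1) * totalBetti F (link K v) ≤
      totalBetti F K := by
  set n := Fintype.card V - Fintype.card (LinkVertex K v) - 1
  let N := n + 1 + (Fintype.card V + Fintype.card (LinkVertex K v) + 1)
  rw [totalBetti_eq_sum_range K (show Fintype.card V < N by omega)]
  refine le_trans ?_ (Finset.sum_le_sum fun i _ => sum_choose_mul_betti_link_le K v i)
  rw [Finset.sum_range_diag_flip N fun s k => n.choose s * betti F (link K v) k,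
    ← Nat.sum_range_choose, Finset.sum_mul]
  refine (Finset.sum_le_sum fun s hs => ?_).trans (Finset.sum_le_sum_of_subset
    (Finset.range_subset_range.2 (show n + 1 ≤ N by omega)))
  rw [Finset.mem_range] at hs
  rw [← Finset.mul_sum, ← totalBetti_eq_sum_range]
  omega

end Totals

/-! ### Maximal simplices and the binomial bound -/

section MaximalSimplices

variable {V : Type*} [LinearOrder V]

theorem isEmpty_of_maximal_empty {K : AbstractSimplicialComplex V}
    (h : ∅ ∈ maximalSimplices K) : IsEmpty V := by
  refine ⟨fun v => ?_⟩
  have h1 : {v} ∈ simplices K := Or.inr (K.singleton_mem v)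
  exact Finset.singleton_ne_empty v (Finset.subset_empty.1 (h.2 h1 (Finset.empty_subset _)))

theorem one_le_betti_zero [Fintype V] [IsEmpty V] (F : Type*) [Field F]
    (K : AbstractSimplicialComplex V) : 1 ≤ betti F K 0 := by
  rw [betti_eq_sum_range K 0 (N := 1) (by simp), Finset.sum_range_one,
    bigradedBetti_eq_sum_complFamily, Finset.powersetCard_zero, Finset.sum_singleton]
  set Q := complFamily (simplices K) ∅
  have hd : ∀ c : Finset V → F, relD F Q c = 0 := by
    intro c
    ext J
    by_cases hJ : J ∈ Q
    · rw [relD_apply_of_mem _ hJ, Finset.eq_empty_of_isEmpty Jᶜ, Finset.sum_empty, Pi.zero_apply]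
    · rw [relD_apply_of_notMem _ hJ, Pi.zero_apply]
  rw [Nat.one_le_iff_ne_zero, ← Nat.pos_iff_ne_zero, relBetti, Module.finrank_pos_iff,
    Submodule.Quotient.nontrivial_iff]
  intro htop
  -- Without vertices the only finite set is `∅` and the differential is zero, so the constant 1 is
  -- a cycle but not a boundary.
  have h1 : (fun _ => 1 : Finset V → F) ∈ relCycles F Q 0 := by
    refine mem_relCycles.2 ⟨hd _, fun J _ => ?_⟩
    rw [Finset.eq_empty_of_isEmpty J]
    exact ⟨⟨subset_rfl, Or.inl (Finset.sdiff_self _)⟩, rfl⟩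
  have h2 : (⟨_, h1⟩ : relCycles F Q 0) ∈ (relBoundaries F Q 0).submoduleOf (relCycles F Q 0) := by
    rw [htop]
    exact Submodule.mem_top
  obtain ⟨w, -, hw⟩ := h2
  have h3 : relD F Q w = fun _ => 1 := hw
  rw [hd] at h3
  exact zero_ne_one (congrFun h3 ∅)

/-- Removing a vertex of a maximal simplex yields a maximal simplex of its link. -/
theorem exists_maximalSimplices_link {K : AbstractSimplicialComplex V} {σ : Finset V}
    (hσ : σ ∈ maximalSimplices K) {v : V} (hv : v ∈ σ) :
    ∃ τ ∈ maximalSimplices (link K v), τ.card + 1 = σ.card := by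
  classical
  have hσK : σ ∈ K.faces := hσ.1.resolve_left (Finset.ne_empty_of_mem hv)
  let e : LinkVertex K v ↪ V := Function.Embedding.subtype _
  have hev : ∀ τ : Finset (LinkVertex K v), v ∉ τ.map e := by
    intro τ h
    obtain ⟨u, -, hu⟩ := Finset.mem_map.1 h
    exact u.2.1 hu
  obtain ⟨τ, hτ⟩ : ∃ τ : Finset (LinkVertex K v), τ.map e = σ.erase v := by
    refine ⟨Finset.subtype _ (σ.erase v), ?_⟩
    refine Finset.subtype_map_of_mem fun u hu => ?_
    obtain ⟨hne, hu⟩ := Finset.mem_erase.1 hu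
    refine ⟨hne, (K.isRelLowerSet_faces hσK).2 ?_ (Finset.insert_nonempty _ _)⟩
    exact Finset.insert_subset hv (Finset.singleton_subset_iff.2 hu)
  have hins : insert v (τ.map e) = σ := by rw [hτ, Finset.insert_erase hv]
  refine ⟨τ, ⟨?_, ?_⟩, ?_⟩
  · rcases τ.eq_empty_or_nonempty with h | h
    · exact Or.inl h
    · exact Or.inr ⟨h, by rw [hins]; exact hσK⟩
  · intro ρ hρ hle
    rcases hρ with rfl | hρ
    · exact Finset.empty_subset _
    · have h1 : insert v (ρ.map e) ⊆ σ := hσ.2 (Or.inr hρ.2) (by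
        rw [← hins]
        exact Finset.insert_subset_insert _ (Finset.map_subset_map.2 hle))
      rw [← hins, Finset.insert_subset_insert_iff (hev ρ), Finset.map_subset_map] at h1
      exact h1
  · rw [← hins, Finset.card_insert_of_notMem (hev τ), Finset.card_map]

end MaximalSimplices

universe u

/-- Induction on the size of the maximal simplex, over all vertex types at once because the link
lives on a new one. A maximal empty simplex means there are no vertices at all, which is the base
case. -/
theorem choose_le_betti_of_maximal (F : Type*) [Field F] (k : ℕ) :
    ∀ {V : Type u} [Fintype V] [LinearOrder V] (K : AbstractSimplicialComplex V),
      ∀ σ ∈ maximalSimplices K, σ.card = k → ∀ i, (Fintype.card V - k).choose i ≤ betti F K i := by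
  induction k with
  | zero =>
    intro V _ _ K σ hσ hc i
    rw [Finset.card_eq_zero] at hc
    subst hc
    have := isEmpty_of_maximal_empty hσ
    rw [Fintype.card_eq_zero]
    rcases i with _ | i
    · exact one_le_betti_zero F K
    · simp
  | succ k ih =>
    intro V _ _ K σ hσ hc i
    obtain ⟨v, hv⟩ := Finset.card_pos.1 (by omega : 0 < σ.card)
    obtain ⟨τ, hτ, hτc⟩ := exists_maximalSimplices_link hσ hv
    refine le_trans ?_ (sum_choose_mul_betti_link_le K v i)
    have hk : τ.card = k := by omega
    have h1 : k ≤ Fintype.card (LinkVertex K v) := hk ▸ Finset.card_le_univ τ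
    have h2 : Fintype.card (LinkVertex K v) < Fintype.card V :=
      Fintype.card_subtype_lt (x := v) fun h => h.1 rfl
    -- The ghost vertices of the link plus the link vertices outside `τ`: Vandermonde's identity for
    -- this splitting matches (b) term by term.
    have h3 : Fintype.card V - (k + 1) = (Fintype.card V - Fintype.card (LinkVertex K v) - 1) +
        (Fintype.card (LinkVertex K v) - k) := by omega
    rw [h3, Nat.add_choose_eq, Finset.Nat.sum_antidiagonal_eq_sum_range_succ_mk]
    exact Finset.sum_le_sum fun s _ => Nat.mul_le_mul_left _ (ih (link K v) τ hτ hk _)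

/-- The infimum in `ℤ` is attained, not a default value, because the set is nonempty and bounded
below by `-1`. -/
theorem exists_maximalSimplices_mdim {V : Type*} [Fintype V] [LinearOrder V]
    (K : AbstractSimplicialComplex V) :
    ∃ σ ∈ maximalSimplices K, (σ.card : ℤ) - 1 = mdim K := by
  have hne : (maximalSimplices K).Nonempty := by
    obtain ⟨σ, hσ⟩ := (Set.toFinite (simplices K)).exists_maximal ⟨∅, Or.inl rfl⟩
    exact ⟨σ, hσ⟩
  have hbdd : BddBelow ((fun σ : Finset V => (σ.card : ℤ) - 1) '' maximalSimplices K) := by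
    refine ⟨-1, ?_⟩
    rintro _ ⟨σ, -, rfl⟩
    change -1 ≤ (σ.card : ℤ) - 1
    omega
  exact Int.csInf_mem (hne.image _) hbdd

end StanleyReisner

theorem theorem1p1 {V : Type*} [Fintype V] [LinearOrder V] (F : Type*) [Field F]
    (K : AbstractSimplicialComplex V) (m : ℕ) (hm : Fintype.card V = m) :
    (∀ i : ℕ, (i : ℤ) ≤ (m : ℤ) - StanleyReisner.mdim K - 1 →
      ((m : ℤ) - StanleyReisner.mdim K - 1).toNat.choose i ≤ StanleyReisner.betti F K i) ∧
    ∀ (v : V) (m_v : ℕ), Fintype.card (StanleyReisner.LinkVertex K v) = m_v →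
      (∀ i j : ℕ,
        (∑ s ∈ Finset.range (j + 1), if s ≤ i then
            ((m - m_v - 1).choose s : ℤ) *
              (StanleyReisner.bigradedBetti F (StanleyReisner.link K v) (i - s) (j - s) : ℤ)
          else 0) +
            (StanleyReisner.bigradedBetti F (StanleyReisner.deletion K v) i (j + 1) : ℤ) -
            (StanleyReisner.bigradedBetti F (StanleyReisner.deletion K v) i j : ℤ) ≤
          (StanleyReisner.bigradedBetti F K i (j + 1) : ℤ)) ∧
      (∀ i : ℕ,
        ∑ s ∈ Finset.range (i + 1), (m - m_v - 1).choose s *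
            StanleyReisner.betti F (StanleyReisner.link K v) (i - s) ≤
          StanleyReisner.betti F K i) ∧
      2 ^ (m - m_v - 1) * StanleyReisner.totalBetti F (StanleyReisner.link K v) ≤
        StanleyReisner.totalBetti F K := by
  subst hm
  refine ⟨fun i _ => ?_, ?_⟩
  · obtain ⟨σ, hσ, hdim⟩ := StanleyReisner.exists_maximalSimplices_mdim K
    have h : ((Fintype.card V : ℤ) - StanleyReisner.mdim K - 1).toNat =
        Fintype.card V - σ.card := by
      omega
    rw [h]
    exact StanleyReisner.choose_le_betti_of_maximal F _ K σ hσ rfl i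
  · rintro v _ rfl
    refine ⟨fun i j => ?_, StanleyReisner.sum_choose_mul_betti_link_le K v,
      StanleyReisner.two_pow_mul_totalBetti_link_le K v⟩
    have h := StanleyReisner.sum_link_add_deletion_le (F := F) K v i j
    rw [← Nat.cast_le (α := ℤ)] at h
    push_cast at h
    linarith
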